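/- Let $g$ be a smooth Riemannian metric on $\mathbb R^n$, let $M\subset\mathbb R^n$ be compact with smooth boundary $\partial M$, and let $dS$ be the Riemannian volume measure of $\partial M$ for the metric induced by $g$. Let $T>0$ and, for $j=1,2$, let $\theta_j:(0,T)\times\mathbb R^n\to\mathbb C$ be smooth and of the form $$\theta_j(t,x)=p_j(t)(x-\gamma_j(t))+\tfrac12\,(x-\gamma_j(t))\,H_j(t)\,(x-\gamma_j(t))+O(|x-\gamma_j(t)|^3)\quad (x\to\gamma_j(t)),$$ where $\gamma_j$ is a smooth path in $\mathbb R^n$, $p_j$ is a smooth path of real covectors, and $H_j(t)\in\mathbb C^{n\times n}$ is symmetric. Suppose that for some $t_0\in(0,T)$ and for both $j=1,2$: (B1) $\gamma_j(t_0)\in\partial M$ and $\dot\gamma_j(t_0)\notin T_{\gamma_j(t_0)}\partial M$; (B2) $p_j(t_0)=\dot\gamma_j(t_0)^\flat$, that is, $p_j(t_0)=g_{\gamma_j(t_0)}(\dot\gamma_j(t_0),\cdot)$; (B3) $\operatorname{Im}H_j(t_0)$ is positive definite. Suppose moreover that $\gamma_1(t_0)=\gamma_2(t_0)=:x_0$ and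 $\dot\gamma_1(t_0)=\dot\gamma_2(t_0)$. Then there is an open neighbourhood $V\subset\mathbb R\times\mathbb R^n$ of $(t_0,x_0)$ such that for every $u\in C_0^\infty(\mathbb R\times\mathbb R^n;\mathbb C)$ with $\operatorname{supp}u\subset V$ the integral below converges for every $\epsilon>0$, and there is $\beta\in\mathbb C$, independent of $\epsilon$, with $$\int_0^\infty\int_{\partial M}e^{i\epsilon^{-1}\theta_1(t,x)}\,\overline{e^{i\epsilon^{-1}\theta_2(t,x)}}\,u(t,x)\,dS(x)\,dt=\beta\,\epsilon^{n/2}+O(\epsilon^{n/2+1})\quad(\epsilon\to0^+),$$ and $\beta\neq0$ if and only if $u(t_0,x_0)\neq0$. -/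

import Mathlib

open MeasureTheory Set Filter Asymptotics
open scoped ContDiff Topology Matrix

/-- A smooth Riemannian metric on `ℝⁿ`: a smooth field of symmetric positive definite
bilinear forms. -/
structure RiemannianMetric (n : ℕ) where
  /-- the bilinear form `g_x` on the tangent space `ℝⁿ` at `x` -/
  toFun : EuclideanSpace ℝ (Fin n) →
    EuclideanSpace ℝ (Fin n) →L[ℝ] EuclideanSpace ℝ (Fin n) →L[ℝ] ℝ
  smooth : ContDiff ℝ ∞ toFun
  symm : ∀ x v w, toFun x v w = toFun x w v
  pos : ∀ x v, v ≠ 0 → 0 < toFun x v v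

namespace RiemannianMetric

variable {n : ℕ}

/-- The covector `v^♭ = g_x(v, ·)` at `x`. -/
noncomputable def flat (g : RiemannianMetric n) (x v : EuclideanSpace ℝ (Fin n)) :
    EuclideanSpace ℝ (Fin n) →L[ℝ] ℝ :=
  g.toFun x v

end RiemannianMetric

/-- `M ⊆ ℝⁿ` is compact with smooth boundary: near each boundary point `x` it is the set
`{ρ ≥ 0}` of a smooth function `ρ` with `dρ(x) ≠ 0`. -/
structure IsCompactSmoothDomain {n : ℕ} (M : Set (EuclideanSpace ℝ (Fin n))) : Prop where
  isCompact : IsCompact M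
  smooth_boundary : ∀ x ∈ frontier M,
    ∃ (W : Set (EuclideanSpace ℝ (Fin n))) (ρ : EuclideanSpace ℝ (Fin n) → ℝ),
      IsOpen W ∧ x ∈ W ∧ ContDiffOn ℝ ∞ ρ W ∧ fderiv ℝ ρ x ≠ 0 ∧
        ∀ y ∈ W, (y ∈ M ↔ 0 ≤ ρ y)

/-- The tangent space at `x` of a smooth hypersurface `S ⊆ ℝⁿ`: the velocities at `x` of the
smooth curves in `S` through `x`. -/
def surfaceTangent {n : ℕ} (S : Set (EuclideanSpace ℝ (Fin n)))
    (x : EuclideanSpace ℝ (Fin n)) : Set (EuclideanSpace ℝ (Fin n)) :=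
  {v | ∃ c : ℝ → EuclideanSpace ℝ (Fin n), ContDiffAt ℝ ∞ c 0 ∧ c 0 = x ∧ deriv c 0 = v ∧
    ∀ᶠ s in 𝓝 (0 : ℝ), c s ∈ S}

/-- `φ`, restricted to the open set `U ⊆ ℝⁿ⁻¹`, is a local parametrization of the smooth
hypersurface `S ⊆ ℝⁿ`: a smooth injective immersion into `S`. (As `S` has dimension `n - 1`, it is
then a diffeomorphism onto an open piece of `S`.) -/
structure IsLocalParam {n : ℕ} (S : Set (EuclideanSpace ℝ (Fin n)))
    (U : Set (EuclideanSpace ℝ (Fin (n - 1))))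
    (φ : EuclideanSpace ℝ (Fin (n - 1)) → EuclideanSpace ℝ (Fin n)) : Prop where
  isOpen : IsOpen U
  smooth : ContDiffOn ℝ ∞ φ U
  injOn : InjOn φ U
  immersion : ∀ a ∈ U, Function.Injective (fderiv ℝ φ a)
  mapsTo : MapsTo φ U S

/-- The matrix `g_{φ(a)}(∂ᵢφ(a), ∂ⱼφ(a))` of the pulled back metric `φ^* g`. -/
noncomputable def pullbackMatrix {n : ℕ} (g : RiemannianMetric n)
    (φ : EuclideanSpace ℝ (Fin (n - 1)) → EuclideanSpace ℝ (Fin n))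
    (a : EuclideanSpace ℝ (Fin (n - 1))) : Matrix (Fin (n - 1)) (Fin (n - 1)) ℝ :=
  Matrix.of fun i j => g.toFun (φ a)
    (fderiv ℝ φ a (EuclideanSpace.single i 1)) (fderiv ℝ φ a (EuclideanSpace.single j 1))

/-- The Riemannian volume of the piece `φ(U)` of a hypersurface: the image under `φ` of the
measure `√(det φ^*g) da` on `U`. -/
noncomputable def paramArea {n : ℕ} (g : RiemannianMetric n)
    (U : Set (EuclideanSpace ℝ (Fin (n - 1))))
    (φ : EuclideanSpace ℝ (Fin (n - 1)) → EuclideanSpace ℝ (Fin n)) :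
    Measure (EuclideanSpace ℝ (Fin n)) :=
  ((volume.restrict U).withDensity
    fun a => ENNReal.ofReal (Real.sqrt (pullbackMatrix g φ a).det)).map φ

/-- The Riemannian volume measure `dS` of a smooth hypersurface `S` with the metric induced by
`g`, as a measure on `ℝⁿ` carried by `S`. The measures `paramArea g U φ` of the local
parametrizations agree on overlaps (change of variables), so their least upper bound is the measure
obtained by gluing them: it restricts to `paramArea g U φ` on each piece `φ(U)`. -/
noncomputable def surfaceMeasure {n : ℕ} (g : RiemannianMetric n)
    (S : Set (EuclideanSpace ℝ (Fin n))) : Measure (EuclideanSpace ℝ (Fin n)) :=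
  sSup {μ | ∃ U φ, IsLocalParam S U φ ∧ μ = paramArea g U φ}

/-- The quadratic form `z H z = ∑ zⱼ Hⱼₖ zₖ` of a complex matrix at a real vector. -/
noncomputable def quadForm {n : ℕ} (H : Matrix (Fin n) (Fin n) ℂ) (z : EuclideanSpace ℝ (Fin n)) : ℂ :=
  ∑ j, ∑ k, (z j : ℂ) * H j k * (z k : ℂ)

/-- `θ` is a smooth phase on `(0,T) × ℝⁿ` of the form
`θ(t,x) = p(t)(x - γ(t)) + ½ (x - γ(t)) H(t) (x - γ(t)) + O(|x - γ(t)|³)` with smooth paths `γ`,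
`p` (`p` being a path of real covectors) and symmetric complex matrices `H(t)`. -/
structure IsBeamPhase {n : ℕ} (T : ℝ) (θ : ℝ × EuclideanSpace ℝ (Fin n) → ℂ)
    (γ : ℝ → EuclideanSpace ℝ (Fin n)) (p : ℝ → EuclideanSpace ℝ (Fin n) →L[ℝ] ℝ)
    (H : ℝ → Matrix (Fin n) (Fin n) ℂ) : Prop where
  smooth_phase : ContDiffOn ℝ ∞ θ (Ioo 0 T ×ˢ univ)
  smooth_path : ContDiffOn ℝ ∞ γ (Ioo 0 T)
  smooth_covector : ContDiffOn ℝ ∞ p (Ioo 0 T)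
  symm : ∀ t ∈ Ioo 0 T, (H t).IsSymm
  expansion : ∀ t ∈ Ioo 0 T,
    (fun x => θ (t, x) - ((p t (x - γ t) : ℝ) + (1 / 2 : ℂ) * quadForm (H t) (x - γ t)))
      =O[𝓝 (γ t)] fun x => ‖x - γ t‖ ^ 3

/-- The conditions at the time `t₀`: the path meets `∂M` transversally, its covector is dual to its
velocity, and the imaginary part of the matrix is positive definite. -/
structure BeamConditions {n : ℕ} (g : RiemannianMetric n) (M : Set (EuclideanSpace ℝ (Fin n)))
    (γ : ℝ → EuclideanSpace ℝ (Fin n)) (p : ℝ → EuclideanSpace ℝ (Fin n) →L[ℝ] ℝ)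
    (H : ℝ → Matrix (Fin n) (Fin n) ℂ) (t₀ : ℝ) : Prop where
  mem_boundary : γ t₀ ∈ frontier M
  transversal : deriv γ t₀ ∉ surfaceTangent (frontier M) (γ t₀)
  covector : p t₀ = g.flat (γ t₀) (deriv γ t₀)
  im_posDef : ((H t₀).map Complex.im).PosDef

/-- The integrand `exp(iθ₁/ε) · conj(exp(iθ₂/ε)) · u`. -/
noncomputable def beamIntegrand {n : ℕ} (θ₁ θ₂ u : ℝ × EuclideanSpace ℝ (Fin n) → ℂ) (ε : ℝ)
    (q : ℝ × EuclideanSpace ℝ (Fin n)) : ℂ :=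
  Complex.exp (Complex.I * (ε : ℂ)⁻¹ * θ₁ q) *
    (starRingEnd ℂ) (Complex.exp (Complex.I * (ε : ℂ)⁻¹ * θ₂ q)) * u q

/-! The product of one beam with the conjugate of the other is `exp(iΨ/ε) u` with the single phase
`Ψ = θ₁ - conj θ₂`. Near `x₀` the boundary is parametrized by a chart `φ` with `φ 0 = x₀`, so in the
coordinates `(τ, w) ↦ (t₀ + τ, φ w)` the integral becomes one over `ℝ × ℝⁿ⁻¹`, of dimension `n`, and
Laplace's method at the origin gives the power `ε^(n/2)`.

The origin is a nondegenerate critical zero of `Ψ` (`chartPhase_critical`). Each `θⱼ` vanishes along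
its path, so its differential at `(t₀, x₀)` is `(τ, z) ↦ pⱼ(z - τ γ̇ⱼ)`. This is real and the same
for both beams, since equal velocities at the same point have equal duals; it therefore cancels in
`θ₁ - conj θ₂`. The imaginary parts add instead. The differential of `Im θⱼ` vanishes along the
whole path, so its Hessian annihilates `(1, γ̇ⱼ)` and depends only on `z - τ γ̇ⱼ`, through `Im
Hⱼ(t₀)` (`IsBeamPhase.tendsto_im_div_sq`). For `z = dφ(w)`, transversality and injectivity of `dφ`
make `z - τ γ̇ⱼ` nonzero unless `(τ, w) = 0`. Hence `Im Ψ ≥ c ‖y‖²` near the origin, and `V` is a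
neighbourhood on which this bound holds.

In `exists_laplace_asymptotics`, the phase is expanded as quadratic `B` plus cubic `C` and the
amplitude `a` to first order. The corrections of relative size `√ε` are odd and integrate to zero;
the rest is of relative size `ε` after the substitution `y = √ε z`. The leading coefficient is `a 0
* ∫ exp(i B(y,y))`. Simultaneous diagonalization of the real and imaginary parts of `B` makes the
Gaussian integral a nonzero multiple of a product of one-dimensional ones, hence nonzero; `a 0` is
the positive surface density times `u (t₀, x₀)`.

The surface measure is a supremum over all parametrizations; `IsGraphChart.surfaceMeasure_restrict`
identifies it over a chart with the usual area integral. -/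

/-- Taylor's theorem in several variables with a big-O remainder. -/
theorem ContDiffAt.taylor_isBigO {E F : Type*} [NormedAddCommGroup E] [NormedSpace ℝ E]
    [NormedAddCommGroup F] [NormedSpace ℝ F] [CompleteSpace F] {f : E → F} {x : E} {n : ℕ}
    (hf : ContDiffAt ℝ (n + 1) f x) :
    (fun y => f (x + y) - ∑ k ∈ Finset.range (n + 1),
      (k.factorial : ℝ)⁻¹ • iteratedFDeriv ℝ k f x (fun _ => y)) =O[𝓝 0]
      fun y => ‖y‖ ^ (n + 1) := by
  have h1 : ∀ᶠ z in 𝓝 x, ContDiffAt ℝ (n + 1) f z := hf.eventually (by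
    exact_mod_cast WithTop.coe_ne_top)
  have hc : ContinuousAt (iteratedFDeriv ℝ (n + 1) f) x :=
    (hf.iteratedFDeriv_right (i := n + 1) (m := 0) (by simp)).continuousAt
  have h2 : ∀ᶠ z in 𝓝 x, ‖iteratedFDeriv ℝ (n + 1) f z‖ < ‖iteratedFDeriv ℝ (n + 1) f x‖ + 1 :=
    hc.norm.eventually_lt_const (by linarith)
  obtain ⟨r, hr, hball⟩ := Metric.eventually_nhds_iff_ball.1 (h1.and h2)
  set C := ‖iteratedFDeriv ℝ (n + 1) f x‖ + 1
  have hC : 0 ≤ C := by positivity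
  refine IsBigO.of_bound C ?_
  filter_upwards [Metric.ball_mem_nhds (0 : E) hr] with y hy
  have hmem : ∀ t ∈ Icc (0 : ℝ) 1, x + t • y ∈ Metric.ball x r := by
    intro t ht
    rw [mem_ball_zero_iff] at hy
    rw [mem_ball_iff_norm, add_sub_cancel_left, norm_smul, Real.norm_eq_abs, abs_of_nonneg ht.1]
    nlinarith [ht.1, ht.2, norm_nonneg y]
  rw [map_add_eq_sum_add_integral_iteratedFDeriv (f := f) (n := n)
    (fun t ht => (hball _ (hmem t ht)).1), add_sub_cancel_left, norm_smul]
  have hint : ‖∫ t in (0 : ℝ)..1, (1 - t) ^ n • iteratedFDeriv ℝ (n + 1) f (x + t • y)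
      (fun _ => y)‖ ≤ (C * ‖y‖ ^ (n + 1)) * |1 - 0| := by
    refine intervalIntegral.norm_integral_le_of_norm_le_const fun t ht => ?_
    rw [uIoc_of_le zero_le_one] at ht
    have ht' : t ∈ Icc (0 : ℝ) 1 := ⟨ht.1.le, ht.2⟩
    rw [norm_smul, norm_pow]
    have ha : ‖1 - t‖ ^ n ≤ 1 := by
      refine pow_le_one₀ (norm_nonneg _) ?_
      rw [Real.norm_eq_abs, abs_le]
      constructor <;> linarith [ht.1, ht.2]
    have hb : ‖iteratedFDeriv ℝ (n + 1) f (x + t • y) (fun _ => y)‖ ≤ C * ‖y‖ ^ (n + 1) := by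
      refine (ContinuousMultilinearMap.le_opNorm _ _).trans ?_
      rw [Finset.prod_const, Finset.card_univ, Fintype.card_fin]
      gcongr
      exact (hball _ (hmem t ht')).2.le
    calc _ ≤ 1 * (C * ‖y‖ ^ (n + 1)) := by gcongr
      _ = _ := one_mul _
  have hfac : ‖((n.factorial : ℝ))⁻¹‖ ≤ 1 := by
    rw [norm_inv, Real.norm_natCast]
    exact inv_le_one_of_one_le₀ (by exact_mod_cast n.factorial_pos)
  calc _ ≤ 1 * ((C * ‖y‖ ^ (n + 1)) * |1 - 0|) := by gcongr
    _ = C * ‖‖y‖ ^ (n + 1)‖ := by simp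

/-! ### Gaussian integrals with a complex quadratic phase. -/

/-- A polynomial times a Gaussian is integrable. -/
theorem integrable_one_add_norm_pow_mul_exp {E : Type*} [NormedAddCommGroup E] [NormedSpace ℝ E]
    [FiniteDimensional ℝ E] [MeasurableSpace E] [BorelSpace E] (μ : Measure E)
    [μ.IsAddHaarMeasure] {c : ℝ} (hc : 0 < c) (k : ℕ) :
    Integrable (fun z : E => (1 + ‖z‖) ^ k * Real.exp (-(c * ‖z‖ ^ 2))) μ := by
  set d := Module.finrank ℝ E + 1
  have hd : (Module.finrank ℝ E : ℝ) < (d : ℝ) := by simp [d]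
  -- The constant combines `(1 + r)^(k+d) ≤ (k+d)! exp(1 + r)` with `r - c r² ≤ 1/(4c)`. The extra
  -- factor `(1 + r)^(-d)` is integrable because `d` exceeds the dimension.
  have hint := (integrable_one_add_norm (μ := μ) hd).const_mul
    (((k + d).factorial : ℝ) * Real.exp (1 + 1 / (4 * c)))
  refine hint.mono' (by fun_prop) (Eventually.of_forall fun z => ?_)
  have hz : 0 < 1 + ‖z‖ := by positivity
  rw [Real.norm_of_nonneg (by positivity), Real.rpow_neg hz.le, Real.rpow_natCast,
    ← div_eq_mul_inv, le_div_iff₀ (by positivity)]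
  have h1 : (1 + ‖z‖) ^ (k + d) ≤ ((k + d).factorial : ℝ) * Real.exp (1 + ‖z‖) := by
    have := Real.pow_div_factorial_le_exp (x := 1 + ‖z‖) hz.le (k + d)
    rwa [div_le_iff₀ (by positivity), mul_comm] at this
  have h2 : 1 + ‖z‖ + -(c * ‖z‖ ^ 2) ≤ 1 + 1 / (4 * c) := by
    have : 1 / (4 * c) - ‖z‖ + c * ‖z‖ ^ 2 = c * (‖z‖ - 1 / (2 * c)) ^ 2 := by
      field_simp; ring
    nlinarith [mul_nonneg hc.le (sq_nonneg (‖z‖ - 1 / (2 * c)))]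
  calc (1 + ‖z‖) ^ k * Real.exp (-(c * ‖z‖ ^ 2)) * (1 + ‖z‖) ^ d
      = (1 + ‖z‖) ^ (k + d) * Real.exp (-(c * ‖z‖ ^ 2)) := by rw [pow_add]; ring
    _ ≤ ((k + d).factorial : ℝ) * Real.exp (1 + ‖z‖) * Real.exp (-(c * ‖z‖ ^ 2)) := by gcongr
    _ = ((k + d).factorial : ℝ) * Real.exp (1 + ‖z‖ + -(c * ‖z‖ ^ 2)) := by
        rw [mul_assoc, ← Real.exp_add]
    _ ≤ _ := by gcongr

/-- Simultaneous diagonalization of two symmetric bilinear forms, one of them positive definite. -/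
theorem exists_basis_simultaneous_diagonal {E : Type*} [AddCommGroup E] [Module ℝ E]
    [FiniteDimensional ℝ E] (A R : E →ₗ[ℝ] E →ₗ[ℝ] ℝ) (hA : ∀ v w, A v w = A w v)
    (hR : ∀ v w, R v w = R w v) (hpos : ∀ v, v ≠ 0 → 0 < A v v) :
    ∃ (b : Module.Basis (Fin (Module.finrank ℝ E)) ℝ E) (d : Fin (Module.finrank ℝ E) → ℝ),
      (∀ i j, A (b i) (b j) = if i = j then 1 else 0) ∧
      ∀ i j, R (b i) (b j) = if i = j then d i else 0 := by
  -- With `A` as inner product, `R` is represented by a self-adjoint operator `S`, and an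
  -- orthonormal eigenbasis of `S` diagonalizes both forms.
  let core : InnerProductSpace.Core ℝ E :=
    { inner := fun v w => A v w
      conj_inner_symm := fun v w => by simpa using hA w v
      re_inner_nonneg := fun v => by
        rcases eq_or_ne v 0 with rfl | hv
        · simp
        · simpa using (hpos v hv).le
      add_left := fun x y z => by simp
      smul_left := fun x y r => by simp
      definite := fun v hv => by
        by_contra h
        exact (hpos v h).ne' hv }
  let _ : NormedAddCommGroup E := core.toNormedAddCommGroup
  let _ : InnerProductSpace ℝ E := InnerProductSpace.ofCore core.toCore
  have hinner : ∀ v w : E, inner ℝ v w = A v w := fun v w => rfl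
  let S : E →ₗ[ℝ] E :=
    { toFun := fun v => (InnerProductSpace.toDual ℝ E).symm (LinearMap.toContinuousLinearMap (R v))
      map_add' := fun v w => by simp
      map_smul' := fun r v => by simp }
  have hS : ∀ v w : E, inner ℝ (S v) w = R v w := fun v w => by
    simp [S]
  have hsym : S.IsSymmetric := fun v w => by
    rw [hS, real_inner_comm, hS, hR]
  let b := hsym.eigenvectorBasis rfl
  have hon : ∀ i j, A (b i) (b j) = if i = j then 1 else 0 := fun i j => by
    rw [← hinner]
    exact orthonormal_iff_ite.1 b.orthonormal i j
  refine ⟨b.toBasis, hsym.eigenvalues rfl, fun i j => by simpa using hon i j, fun i j => ?_⟩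
  simp only [OrthonormalBasis.coe_toBasis]
  rw [← hS, hsym.apply_eigenvectorBasis rfl i, inner_smul_left, hinner]
  have := hon i j
  simp only [b] at this
  rw [this]
  split_ifs <;> simp

/-- The Gaussian integral of a complex quadratic form with positive definite imaginary part does
not vanish. -/
theorem integral_cexp_quadratic_ne_zero {E : Type*} [NormedAddCommGroup E] [NormedSpace ℝ E]
    [FiniteDimensional ℝ E] [MeasurableSpace E] [BorelSpace E] (μ : Measure E)
    [μ.IsAddHaarMeasure] (B : E →L[ℝ] E →L[ℝ] ℂ) (hB : ∀ v w, B v w = B w v)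
    (hpos : ∀ v, v ≠ 0 → 0 < (B v v).im) :
    ∫ y, Complex.exp (Complex.I * B y y) ∂μ ≠ 0 := by
  let A : E →ₗ[ℝ] E →ₗ[ℝ] ℝ := LinearMap.mk₂ ℝ (fun v w => (B v w).im)
    (by intros; simp) (by intros; simp) (by intros; simp) (by intros; simp)
  let R : E →ₗ[ℝ] E →ₗ[ℝ] ℝ := LinearMap.mk₂ ℝ (fun v w => (B v w).re)
    (by intros; simp) (by intros; simp) (by intros; simp) (by intros; simp)
  obtain ⟨b, d, hbA, hbR⟩ := exists_basis_simultaneous_diagonal A R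
    (fun v w => by simp [A, hB v w]) (fun v w => by simp [R, hB v w])
    (fun v hv => by simpa [A] using hpos v hv)
  let e : E ≃L[ℝ] (Fin (Module.finrank ℝ E) → ℝ) := b.equivFun.toContinuousLinearEquiv
  have hBb : ∀ i j, B (b i) (b j) = if i = j then ((d i : ℂ) + Complex.I) else 0 := by
    intro i j
    have h1 := hbA i j
    have h2 := hbR i j
    simp only [A, R, LinearMap.mk₂_apply] at h1 h2
    apply Complex.ext
    · rw [h2]; split_ifs <;> simp
    · rw [h1]; split_ifs <;> simp
  have hQ : ∀ x : Fin (Module.finrank ℝ E) → ℝ,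
      B (e.symm x) (e.symm x) = ∑ i, ((d i : ℂ) + Complex.I) * (x i : ℂ) ^ 2 := by
    intro x
    have hx : e.symm x = ∑ i, x i • b i := by
      simp [e, Module.Basis.equivFun_symm_apply]
    rw [hx]
    simp only [map_sum, map_smul, sum_apply, smul_apply,
      hBb]
    refine Finset.sum_congr rfl fun i _ => ?_
    simp
    ring
  have hmap : ∫ y, Complex.exp (Complex.I * B y y) ∂μ =
      ∫ x, Complex.exp (Complex.I * B (e.symm x) (e.symm x)) ∂(μ.map e) := by
    have := e.toHomeomorph.measurableEmbedding.integral_map (μ := μ)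
      (fun x => Complex.exp (Complex.I * B (e.symm x) (e.symm x)))
    refine Eq.trans ?_ this.symm
    simp
  have hH : (μ.map e).IsAddHaarMeasure := e.isAddHaarMeasure_map μ
  rw [hmap, Measure.isAddLeftInvariant_eq_smul (μ.map e) volume, integral_smul_nnreal_measure]
  refine smul_ne_zero ?_ ?_
  · exact (Measure.addHaarScalarFactor_pos_of_isAddHaarMeasure _ _).ne'
  -- Diagonal entries of `B` are `d i + i`, and `i(d + i) = -(1 - i d)` has real part `-1`: each
  -- factor is a convergent Gaussian with value `(π/(1 - i d))^(1/2)`.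
  have hprod : ∀ x : Fin (Module.finrank ℝ E) → ℝ,
      Complex.exp (Complex.I * B (e.symm x) (e.symm x)) =
      ∏ i, Complex.exp (-(1 - Complex.I * d i) * (x i : ℂ) ^ 2) := by
    intro x
    rw [hQ, Finset.mul_sum, Complex.exp_sum]
    refine Finset.prod_congr rfl fun i _ => ?_
    congr 1
    linear_combination (x i : ℂ) ^ 2 * Complex.I_mul_I
  simp_rw [hprod]
  rw [integral_fintype_prod_volume_eq_prod
    (f := fun i (t : ℝ) => Complex.exp (-(1 - Complex.I * d i) * (t : ℂ) ^ 2))]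
  refine Finset.prod_ne_zero_iff.2 fun i _ => ?_
  rw [integral_gaussian_complex (by simp)]
  have h0 : (1 - Complex.I * d i) ≠ 0 := by
    intro h
    simpa using congrArg Complex.re h
  rw [Ne, Complex.cpow_eq_zero_iff]
  rintro ⟨h, -⟩
  rw [div_eq_zero_iff] at h
  rcases h with h | h
  · exact Real.pi_ne_zero (by exact_mod_cast h)
  · exact h0 h

/-! ### Taylor bounds for the exponential without smallness assumptions. -/

theorem Complex.norm_exp_sub_one_le_max (w : ℂ) :
    ‖Complex.exp w - 1‖ ≤ 2 * ‖w‖ * max 1 (Real.exp w.re) := by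
  have hm : 1 ≤ max 1 (Real.exp w.re) := le_max_left _ _
  have hr : Real.exp w.re ≤ max 1 (Real.exp w.re) := le_max_right _ _
  rcases le_total ‖w‖ 1 with h | h
  · exact (Complex.norm_exp_sub_one_le h).trans (le_mul_of_one_le_right (by positivity) hm)
  · have h1 : ‖Complex.exp w - 1‖ ≤ Real.exp w.re + 1 := by
      simpa [Complex.norm_exp] using norm_sub_le (Complex.exp w) 1
    nlinarith

/-- For `‖w‖ ≤ 1` this is the power series bound, otherwise the triangle inequality. No smallness of
`w` is needed, which matters because `w` will be of size `‖y‖³/ε`. -/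
theorem Complex.norm_exp_sub_one_sub_id_le_max (w : ℂ) :
    ‖Complex.exp w - 1 - w‖ ≤ 3 * ‖w‖ ^ 2 * max 1 (Real.exp w.re) := by
  have hm : 1 ≤ max 1 (Real.exp w.re) := le_max_left _ _
  have hr : Real.exp w.re ≤ max 1 (Real.exp w.re) := le_max_right _ _
  rcases le_total ‖w‖ 1 with h | h
  · refine (Complex.norm_exp_sub_one_sub_id_le h).trans ?_
    nlinarith [sq_nonneg ‖w‖]
  · have h1 : ‖Complex.exp w - 1 - w‖ ≤ Real.exp w.re + 1 + ‖w‖ := by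
      refine (norm_sub_le _ _).trans ?_
      gcongr
      simpa [Complex.norm_exp] using norm_sub_le (Complex.exp w) 1
    have h2 : ‖w‖ ≤ ‖w‖ ^ 2 := by nlinarith
    have h3 : 1 ≤ ‖w‖ ^ 2 := by nlinarith
    nlinarith [mul_le_mul h3 hm zero_le_one (by positivity), mul_le_mul h3 hr
      (Real.exp_nonneg _) (by positivity), mul_le_mul h2 hm zero_le_one (by positivity)]

/-- Absorbs the maximum in the preceding bounds: if both exponentials are dominated by the same
Gaussian, so is the product. -/
theorem Complex.exp_re_mul_max_le {z₁ z₂ : ℂ} {m : ℝ} (h₁ : z₁.re ≤ m) (h₂ : z₂.re ≤ m) :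
    Real.exp z₂.re * max 1 (Real.exp (z₁ - z₂).re) ≤ Real.exp m := by
  rw [mul_max_of_nonneg _ _ (Real.exp_nonneg _), mul_one, ← Real.exp_add, Complex.sub_re]
  refine max_le (Real.exp_le_exp.2 h₂) (Real.exp_le_exp.2 ?_)
  linarith

theorem Complex.norm_exp_sub_exp_le {z₁ z₂ : ℂ} {m : ℝ} (h₁ : z₁.re ≤ m) (h₂ : z₂.re ≤ m) :
    ‖Complex.exp z₁ - Complex.exp z₂‖ ≤ 2 * ‖z₁ - z₂‖ * Real.exp m := by
  have h : Complex.exp z₁ - Complex.exp z₂ = Complex.exp z₂ * (Complex.exp (z₁ - z₂) - 1) := by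
    rw [mul_sub, ← Complex.exp_add]; simp
  rw [h, norm_mul, Complex.norm_exp]
  calc _ ≤ Real.exp z₂.re * (2 * ‖z₁ - z₂‖ * max 1 (Real.exp (z₁ - z₂).re)) := by
        gcongr; exact Complex.norm_exp_sub_one_le_max _
    _ = 2 * ‖z₁ - z₂‖ * (Real.exp z₂.re * max 1 (Real.exp (z₁ - z₂).re)) := by ring
    _ ≤ _ := by gcongr; exact Complex.exp_re_mul_max_le h₁ h₂

theorem Complex.norm_exp_sub_exp_mul_le {z₁ z₂ : ℂ} {m : ℝ} (h₁ : z₁.re ≤ m) (h₂ : z₂.re ≤ m) :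
    ‖Complex.exp z₁ - Complex.exp z₂ * (1 + (z₁ - z₂))‖ ≤ 3 * ‖z₁ - z₂‖ ^ 2 * Real.exp m := by
  have h : Complex.exp z₁ - Complex.exp z₂ * (1 + (z₁ - z₂)) =
      Complex.exp z₂ * (Complex.exp (z₁ - z₂) - 1 - (z₁ - z₂)) := by
    have : Complex.exp z₁ = Complex.exp z₂ * Complex.exp (z₁ - z₂) := by
      rw [← Complex.exp_add]; simp
    rw [this]; ring
  rw [h, norm_mul, Complex.norm_exp]
  calc _ ≤ Real.exp z₂.re * (3 * ‖z₁ - z₂‖ ^ 2 * max 1 (Real.exp (z₁ - z₂).re)) := by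
        gcongr; exact Complex.norm_exp_sub_one_sub_id_le_max _
    _ = 3 * ‖z₁ - z₂‖ ^ 2 * (Real.exp z₂.re * max 1 (Real.exp (z₁ - z₂).re)) := by ring
    _ ≤ _ := by gcongr; exact Complex.exp_re_mul_max_le h₁ h₂

theorem Complex.re_I_mul_inv_mul (ε : ℝ) (z : ℂ) :
    (Complex.I * (ε : ℂ)⁻¹ * z).re = -(ε⁻¹ * z.im) := by
  rw [← Complex.ofReal_inv]
  simp [Complex.mul_re]

theorem Complex.norm_I_mul_inv_mul {ε : ℝ} (hε : 0 < ε) (z : ℂ) :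
    ‖Complex.I * (ε : ℂ)⁻¹ * z‖ = ε⁻¹ * ‖z‖ := by
  simp [abs_of_pos hε]

/-! ### Laplace's method for a complex phase. -/

section Laplace

variable {E : Type*} [NormedAddCommGroup E] [NormedSpace ℝ E]

/-- Second and third order expansion of a function with vanishing value and differential. -/
theorem exists_quadratic_cubic_expansion {Ψ : E → ℂ} (hΨ : ContDiffAt ℝ 4 Ψ 0) (h0 : Ψ 0 = 0)
    (h1 : fderiv ℝ Ψ 0 = 0) :
    ∃ (B : E →L[ℝ] E →L[ℝ] ℂ) (C : E → ℂ) (K : ℝ), (∀ v w, B v w = B w v) ∧ Continuous C ∧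
      (∀ y, C (-y) = -C y) ∧ 0 ≤ K ∧ (∀ y, ‖C y‖ ≤ K * ‖y‖ ^ 3) ∧
      ∀ᶠ y in 𝓝 0, ‖Ψ y - (B y y + C y)‖ ≤ K * ‖y‖ ^ 4 := by
  have hT := ContDiffAt.taylor_isBigO (n := 3) (f := Ψ) (x := 0) (by exact_mod_cast hΨ)
  have hsymm : IsSymmSndFDerivAt ℝ Ψ 0 :=
    hΨ.isSymmSndFDerivAt (by simp; norm_num)
  obtain ⟨K, hK⟩ := hT.bound
  set D := iteratedFDeriv ℝ 3 Ψ 0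
  have hc : Continuous fun y : E => D fun _ => y := by fun_prop
  refine ⟨(1 / 2 : ℝ) • fderiv ℝ (fderiv ℝ Ψ) 0, fun y => (6 : ℝ)⁻¹ • D fun _ => y,
    max (‖D‖) K, fun v w => ?_, by fun_prop, fun y => ?_, le_max_of_le_left (norm_nonneg _),
    fun y => ?_, ?_⟩
  · simp only [smul_apply]
    rw [hsymm.eq v w]
  · have := D.map_smul_univ (fun _ => (-1 : ℝ)) (fun _ => y)
    simp only [neg_smul, one_smul, Finset.prod_const, Finset.card_univ, Fintype.card_fin] at this
    change (6 : ℝ)⁻¹ • D (fun _ => -y) = _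
    rw [this]
    norm_num
  · have h := D.le_opNorm (fun _ => y)
    rw [Finset.prod_const, Finset.card_univ, Fintype.card_fin] at h
    rw [norm_smul]
    calc _ ≤ 1 * (‖D‖ * ‖y‖ ^ 3) := by gcongr; norm_num
      _ ≤ _ := by rw [one_mul]; gcongr; exact le_max_left _ _
  · filter_upwards [hK] with y hy
    simp only [Finset.sum_range_succ, Finset.range_zero, Finset.sum_empty, zero_add,
      iteratedFDeriv_zero_apply, iteratedFDeriv_one_apply, iteratedFDeriv_two_apply, h0, h1,
      Nat.factorial] at hy
    norm_num at hy
    refine le_trans (le_of_eq ?_) (hy.trans ?_)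
    · congr 2
      simp [D]
    · gcongr
      exact le_max_right _ _

variable [FiniteDimensional ℝ E] [MeasurableSpace E] [BorelSpace E]

theorem integrable_cexp_quadratic_mul (μ : Measure E) [μ.IsAddHaarMeasure]
    (B : E →L[ℝ] E →L[ℝ] ℂ) {c : ℝ} (hc : 0 < c) (hpos : ∀ y, c * ‖y‖ ^ 2 ≤ (B y y).im)
    {ε : ℝ} (hε : 0 < ε) {h : E → ℂ} (hh : Continuous h) {K : ℝ} {k : ℕ}
    (hb : ∀ y, ‖h y‖ ≤ K * (1 + ‖y‖) ^ k) :
    Integrable (fun y => Complex.exp (Complex.I * (ε : ℂ)⁻¹ * B y y) * h y) μ := by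
  refine ((integrable_one_add_norm_pow_mul_exp μ (mul_pos (inv_pos.2 hε) hc) k).const_mul
    K).mono' ?_ (Eventually.of_forall fun y => ?_)
  · refine Continuous.aestronglyMeasurable ?_
    fun_prop
  · rw [norm_mul, Complex.norm_exp, Complex.re_I_mul_inv_mul, mul_comm]
    rw [← mul_assoc]
    refine mul_le_mul (hb y) (Real.exp_le_exp.2 (neg_le_neg ?_)) (Real.exp_nonneg _)
      ((norm_nonneg _).trans (hb y))
    rw [mul_assoc]
    exact mul_le_mul_of_nonneg_left (hpos y) (inv_nonneg.2 hε.le)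


/-- Evaluating both bounds at `s • y` and dividing by `s²`, the cubic and quartic terms disappear as
`s → 0⁺`. The quadratic part thus inherits the same constant `c` as the phase. -/
theorem im_quadratic_ge_of_expansion {E : Type*} [NormedAddCommGroup E] [NormedSpace ℝ E]
    {Ψ C : E → ℂ} {B : E →L[ℝ] E →L[ℝ] ℂ} {K c : ℝ}
    (hC : ∀ y, ‖C y‖ ≤ K * ‖y‖ ^ 3) (hexp : ∀ᶠ y in 𝓝 0, ‖Ψ y - (B y y + C y)‖ ≤ K * ‖y‖ ^ 4)
    (him : ∀ᶠ y in 𝓝 0, c * ‖y‖ ^ 2 ≤ (Ψ y).im) (y : E) : c * ‖y‖ ^ 2 ≤ (B y y).im := by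
  have hten : Tendsto (fun s : ℝ => s • y) (𝓝[>] 0) (𝓝 0) := by
    have : Tendsto (fun s : ℝ => s • y) (𝓝 0) (𝓝 ((0 : ℝ) • y)) :=
      (continuous_id.smul continuous_const).tendsto 0
    rw [zero_smul] at this
    exact this.mono_left nhdsWithin_le_nhds
  have hlim : Tendsto (fun s : ℝ => (B y y).im + K * s * ‖y‖ ^ 3 + K * s ^ 2 * ‖y‖ ^ 4) (𝓝[>] 0)
      (𝓝 ((B y y).im + K * 0 * ‖y‖ ^ 3 + K * 0 ^ 2 * ‖y‖ ^ 4)) := by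
    refine Tendsto.mono_left ?_ nhdsWithin_le_nhds
    exact Continuous.tendsto (by fun_prop) _
  simp only [mul_zero, zero_mul, add_zero, ne_eq, OfNat.ofNat_ne_zero, not_false_eq_true,
    zero_pow] at hlim
  refine ge_of_tendsto hlim ?_
  filter_upwards [hten.eventually hexp, hten.eventually him, self_mem_nhdsWithin] with s h1 h2 hs
  have hs : 0 < s := hs
  have h3 := hC (s • y)
  have h4 := (Complex.abs_im_le_norm _).trans h1
  have h5 := (Complex.abs_im_le_norm _).trans h3
  simp only [norm_smul, Real.norm_of_nonneg hs.le, map_smul, smul_apply, Complex.sub_im,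
    Complex.add_im, smul_smul, Complex.smul_im, smul_eq_mul] at h2 h4 h5
  have h6 := (abs_le.1 h4).2
  have h7 := (abs_le.1 h5).2
  have h8 : s ^ 2 * (c * ‖y‖ ^ 2) ≤
      s ^ 2 * ((B y y).im + K * s * ‖y‖ ^ 3 + K * s ^ 2 * ‖y‖ ^ 4) := by
    nlinarith
  exact le_of_mul_le_mul_left h8 (by positivity)

/-- Pointwise comparison of an oscillatory Gaussian with its second order expansion. -/
theorem exists_norm_sub_expansion_le {E : Type*} [NormedAddCommGroup E] [NormedSpace ℝ E]
    {Ψ C a : E → ℂ} {B : E →L[ℝ] E →L[ℝ] ℂ} {K c A : ℝ} (hK : 0 ≤ K)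
    (hC : ∀ y, ‖C y‖ ≤ K * ‖y‖ ^ 3) (hexp : ∀ᶠ y in 𝓝 0, ‖Ψ y - (B y y + C y)‖ ≤ K * ‖y‖ ^ 4)
    (hB : ∀ y, c * ‖y‖ ^ 2 ≤ (B y y).im)
    (him : ∀ᶠ y in 𝓝 0, c * ‖y‖ ^ 2 ≤ (Ψ y).im) (him' : ∀ y, a y ≠ 0 → c * ‖y‖ ^ 2 ≤ (Ψ y).im)
    (hA : ∀ y, ‖a y‖ ≤ A) (L : E →L[ℝ] ℂ)
    (hL : (fun y => a y - (a 0 + L y)) =O[𝓝 0] fun y => ‖y‖ ^ 2) :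
    ∃ K' : ℝ, ∀ ε : ℝ, 0 < ε → ∀ y,
      ‖Complex.exp (Complex.I * (ε : ℂ)⁻¹ * Ψ y) * a y -
        Complex.exp (Complex.I * (ε : ℂ)⁻¹ * B y y) *
          (a 0 + (L y + Complex.I * (ε : ℂ)⁻¹ * C y * a 0))‖ ≤
      K' * (‖y‖ ^ 2 + ε⁻¹ * ‖y‖ ^ 4 + ε⁻¹ ^ 2 * ‖y‖ ^ 6) *
        Real.exp (-(ε⁻¹ * (c * ‖y‖ ^ 2))) := by
  have hA0 : 0 ≤ A := (norm_nonneg _).trans (hA 0)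
  obtain ⟨K₁, hK₁⟩ := hL.bound
  obtain ⟨δ₀, hδ₀, hball⟩ := Metric.eventually_nhds_iff_ball.1 ((hexp.and him).and hK₁)
  set δ := min δ₀ 1
  have hδ : 0 < δ := by positivity
  -- `M₁` adds up the four errors of the expansion inside the ball of radius `δ`; `M₂` is for the
  -- region outside. Taking `δ ≤ 1` lets the quartic remainder be absorbed into a cubic bound.
  set M₁ := |K₁| + 4 * K * ‖L‖ + A * (12 * K ^ 2 + K) with hM₁
  set M₂ := A / δ ^ 2 + (A / δ ^ 2 + ‖L‖ / δ + K * A / δ) with hM₂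
  have hM₁0 : 0 ≤ M₁ := by positivity
  have hM₂0 : 0 ≤ M₂ := by positivity
  refine ⟨M₁ + M₂, fun ε hε y => ?_⟩
  have hε' : 0 < ε⁻¹ := inv_pos.2 hε
  set X := Complex.exp (Complex.I * (ε : ℂ)⁻¹ * Ψ y) with hX
  set Z := Complex.exp (Complex.I * (ε : ℂ)⁻¹ * B y y) with hZ
  set G := Real.exp (-(ε⁻¹ * (c * ‖y‖ ^ 2))) with hG
  set S := ‖y‖ ^ 2 + ε⁻¹ * ‖y‖ ^ 4 + ε⁻¹ ^ 2 * ‖y‖ ^ 6 with hS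
  have hS2 : ‖y‖ ^ 2 ≤ S := by
    have : 0 ≤ ε⁻¹ * ‖y‖ ^ 4 + ε⁻¹ ^ 2 * ‖y‖ ^ 6 := by positivity
    linarith
  have hS4 : ε⁻¹ * ‖y‖ ^ 4 ≤ S := by
    have : 0 ≤ ‖y‖ ^ 2 + ε⁻¹ ^ 2 * ‖y‖ ^ 6 := by positivity
    linarith
  have hS6 : ε⁻¹ ^ 2 * ‖y‖ ^ 6 ≤ S := by
    have : 0 ≤ ‖y‖ ^ 2 + ε⁻¹ * ‖y‖ ^ 4 := by positivity
    linarith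
  have hre : ∀ z : ℂ, c * ‖y‖ ^ 2 ≤ z.im →
      (Complex.I * (ε : ℂ)⁻¹ * z).re ≤ -(ε⁻¹ * (c * ‖y‖ ^ 2)) := fun z hz => by
    rw [Complex.re_I_mul_inv_mul]
    exact neg_le_neg (mul_le_mul_of_nonneg_left hz hε'.le)
  have hG0 : 0 < G := Real.exp_pos _
  have hZG : ‖Z‖ ≤ G := by
    rw [hZ, Complex.norm_exp]
    exact Real.exp_le_exp.2 (hre _ (hB y))
  have hLy := L.le_opNorm y
  by_cases hy : ‖y‖ < δ
  · obtain ⟨⟨h1, h2⟩, h3⟩ := hball y (by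
      rw [mem_ball_zero_iff]; exact hy.trans_le (min_le_left _ _))
    have hy1 : ‖y‖ ≤ 1 := (hy.trans_le (min_le_right _ _)).le
    have hXG : ‖X‖ ≤ G := by
      rw [hX, Complex.norm_exp]
      exact Real.exp_le_exp.2 (hre _ h2)
    set w := Complex.I * (ε : ℂ)⁻¹ * Ψ y - Complex.I * (ε : ℂ)⁻¹ * B y y with hw
    have hwe : w = Complex.I * (ε : ℂ)⁻¹ * (Ψ y - B y y) := by rw [hw]; ring
    have hdiff : ‖Ψ y - B y y‖ ≤ 2 * K * ‖y‖ ^ 3 := by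
      have : Ψ y - B y y = (Ψ y - (B y y + C y)) + C y := by ring
      rw [this]
      refine (norm_add_le _ _).trans ?_
      have h5 : K * ‖y‖ ^ 4 ≤ K * ‖y‖ ^ 3 :=
        mul_le_mul_of_nonneg_left (pow_le_pow_of_le_one (norm_nonneg y) hy1 (by norm_num)) hK
      linarith [hC y]
    have hwn : ‖w‖ ≤ ε⁻¹ * (2 * K * ‖y‖ ^ 3) := by
      rw [hwe, Complex.norm_I_mul_inv_mul hε]
      gcongr
    have e1 : ‖X - Z‖ ≤ 2 * ‖w‖ * G := Complex.norm_exp_sub_exp_le (hre _ h2) (hre _ (hB y))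
    have e2 : ‖X - Z * (1 + w)‖ ≤ 3 * ‖w‖ ^ 2 * G :=
      Complex.norm_exp_sub_exp_mul_le (hre _ h2) (hre _ (hB y))
    have e3 : ‖w - Complex.I * (ε : ℂ)⁻¹ * C y‖ ≤ ε⁻¹ * (K * ‖y‖ ^ 4) := by
      have : w - Complex.I * (ε : ℂ)⁻¹ * C y =
          Complex.I * (ε : ℂ)⁻¹ * (Ψ y - (B y y + C y)) := by rw [hwe]; ring
      rw [this, Complex.norm_I_mul_inv_mul hε]
      gcongr
    have e4 : ‖a y - (a 0 + L y)‖ ≤ |K₁| * ‖y‖ ^ 2 := by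
      refine h3.trans ?_
      rw [Real.norm_of_nonneg (by positivity)]
      gcongr
      exact le_abs_self _
    -- The four errors are: the Taylor remainder of the amplitude, the phase correction times its
    -- linear part, the second order remainder of the exponential, and the quartic remainder of the
    -- phase. Each is at most a constant times `S * G`.
    have hdec : X * a y - Z * (a 0 + (L y + Complex.I * (ε : ℂ)⁻¹ * C y * a 0)) =
        X * (a y - (a 0 + L y)) + (X - Z) * L y + a 0 * (X - Z * (1 + w)) +
          a 0 * (Z * (w - Complex.I * (ε : ℂ)⁻¹ * C y)) := by ring
    rw [hdec]
    have t1 : ‖X * (a y - (a 0 + L y))‖ ≤ |K₁| * S * G := by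
      rw [norm_mul]
      calc _ ≤ G * (|K₁| * S) := by
            gcongr
            exact e4.trans (by gcongr)
        _ = _ := by ring
    have t2 : ‖(X - Z) * L y‖ ≤ 4 * K * ‖L‖ * S * G := by
      rw [norm_mul]
      calc _ ≤ (2 * (ε⁻¹ * (2 * K * ‖y‖ ^ 3)) * G) * (‖L‖ * ‖y‖) := by
            gcongr
            exact e1.trans (by gcongr)
        _ = 4 * K * ‖L‖ * (ε⁻¹ * ‖y‖ ^ 4) * G := by ring
        _ ≤ _ := by gcongr
    have t3 : ‖a 0 * (X - Z * (1 + w))‖ ≤ A * (12 * K ^ 2) * S * G := by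
      rw [norm_mul]
      calc _ ≤ A * (3 * (ε⁻¹ * (2 * K * ‖y‖ ^ 3)) ^ 2 * G) := by
            gcongr
            · exact hA 0
            · exact e2.trans (by gcongr)
        _ = A * (12 * K ^ 2) * (ε⁻¹ ^ 2 * ‖y‖ ^ 6) * G := by ring
        _ ≤ _ := by gcongr
    have t4 : ‖a 0 * (Z * (w - Complex.I * (ε : ℂ)⁻¹ * C y))‖ ≤ A * K * S * G := by
      rw [norm_mul, norm_mul]
      calc _ ≤ A * (G * (ε⁻¹ * (K * ‖y‖ ^ 4))) := by
            gcongr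
            exact hA 0
        _ = A * K * (ε⁻¹ * ‖y‖ ^ 4) * G := by ring
        _ ≤ _ := by gcongr
    calc _ ≤ |K₁| * S * G + 4 * K * ‖L‖ * S * G + A * (12 * K ^ 2) * S * G + A * K * S * G :=
          (norm_add_le _ _).trans (add_le_add ((norm_add_le _ _).trans (add_le_add
            ((norm_add_le _ _).trans (add_le_add t1 t2)) t3)) t4)
      _ = M₁ * S * G := by rw [hM₁]; ring
      _ ≤ (M₁ + M₂) * S * G := by gcongr; linarith
  -- Away from the origin no cancellation is needed: the terms are bounded separately, and powers of
  -- `‖y‖/δ ≥ 1` raise them to the degrees occurring in `S`.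
  · have hy : δ ≤ ‖y‖ := not_lt.1 hy
    have r1 : 1 ≤ ‖y‖ / δ := (one_le_div hδ).2 hy
    have r2 : 1 ≤ ‖y‖ ^ 2 / δ ^ 2 := by
      rw [← div_pow]; exact one_le_pow₀ r1
    have t1 : ‖X * a y‖ ≤ A / δ ^ 2 * S * G := by
      by_cases ha : a y = 0
      · rw [ha, mul_zero, norm_zero]; positivity
      · have hXG : ‖X‖ ≤ G := by
          rw [hX, Complex.norm_exp]
          exact Real.exp_le_exp.2 (hre _ (him' y ha))
        rw [norm_mul]
        calc _ ≤ G * A := by gcongr; exact hA y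
          _ ≤ G * A * (‖y‖ ^ 2 / δ ^ 2) := le_mul_of_one_le_right (by positivity) r2
          _ = A / δ ^ 2 * ‖y‖ ^ 2 * G := by ring
          _ ≤ _ := by gcongr
    have t2 : ‖Z * (a 0 + (L y + Complex.I * (ε : ℂ)⁻¹ * C y * a 0))‖ ≤
        (A / δ ^ 2 + ‖L‖ / δ + K * A / δ) * S * G := by
      rw [norm_mul]
      have u1 : ‖a 0‖ ≤ A / δ ^ 2 * S := by
        calc _ ≤ A * (‖y‖ ^ 2 / δ ^ 2) := (hA 0).trans (le_mul_of_one_le_right hA0 r2)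
          _ = A / δ ^ 2 * ‖y‖ ^ 2 := by ring
          _ ≤ _ := by gcongr
      have u2 : ‖L y‖ ≤ ‖L‖ / δ * S := by
        calc _ ≤ ‖L‖ * ‖y‖ * (‖y‖ / δ) := hLy.trans (le_mul_of_one_le_right (by positivity) r1)
          _ = ‖L‖ / δ * ‖y‖ ^ 2 := by ring
          _ ≤ _ := by gcongr
      have u3 : ‖Complex.I * (ε : ℂ)⁻¹ * C y * a 0‖ ≤ K * A / δ * S := by
        rw [norm_mul, Complex.norm_I_mul_inv_mul hε]
        calc _ ≤ ε⁻¹ * (K * ‖y‖ ^ 3) * A := by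
              gcongr
              · exact hC y
              · exact hA 0
          _ ≤ ε⁻¹ * (K * ‖y‖ ^ 3) * A * (‖y‖ / δ) :=
              le_mul_of_one_le_right (by positivity) r1
          _ = K * A / δ * (ε⁻¹ * ‖y‖ ^ 4) := by ring
          _ ≤ _ := by gcongr
      calc _ ≤ G * (A / δ ^ 2 * S + (‖L‖ / δ * S + K * A / δ * S)) := by
            gcongr
            exact (norm_add_le _ _).trans (add_le_add u1 ((norm_add_le _ _).trans
              (add_le_add u2 u3)))
        _ = _ := by ring
    calc _ ≤ A / δ ^ 2 * S * G + (A / δ ^ 2 + ‖L‖ / δ + K * A / δ) * S * G :=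
          (norm_sub_le _ _).trans (add_le_add t1 t2)
      _ = M₂ * S * G := by rw [hM₂]; ring
      _ ≤ (M₁ + M₂) * S * G := by gcongr; linarith

/-- **Laplace's method** for a complex phase with a nondegenerate critical point. -/
theorem exists_laplace_asymptotics {E : Type*} [NormedAddCommGroup E] [NormedSpace ℝ E]
    [FiniteDimensional ℝ E] [MeasurableSpace E] [BorelSpace E] (μ : Measure E)
    [μ.IsAddHaarMeasure] {Ψ : E → ℂ} (hΨ : ContDiffAt ℝ 4 Ψ 0) (h0 : Ψ 0 = 0)
    (h1 : fderiv ℝ Ψ 0 = 0) {c : ℝ} (hc : 0 < c)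
    (him : ∀ᶠ y in 𝓝 0, c * ‖y‖ ^ 2 ≤ (Ψ y).im) :
    ∃ G : ℂ, G ≠ 0 ∧ ∀ (a : E → ℂ) (A : ℝ), (∀ y, a y ≠ 0 → c * ‖y‖ ^ 2 ≤ (Ψ y).im) →
      (∀ y, ‖a y‖ ≤ A) → ContDiffAt ℝ 2 a 0 →
      (∀ ε : ℝ, 0 < ε → AEStronglyMeasurable
        (fun y => Complex.exp (Complex.I * (ε : ℂ)⁻¹ * Ψ y) * a y) μ) →
      (fun ε : ℝ => ∫ y, Complex.exp (Complex.I * (ε : ℂ)⁻¹ * Ψ y) * a y ∂μ -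
        G * a 0 * ((ε ^ ((Module.finrank ℝ E : ℝ) / 2) : ℝ) : ℂ)) =O[𝓝[>] 0]
        fun ε : ℝ => ε ^ ((Module.finrank ℝ E : ℝ) / 2 + 1) := by
  obtain ⟨B, C, K, hBs, hCc, hCodd, hK, hC, hexp⟩ := exists_quadratic_cubic_expansion hΨ h0 h1
  have hB := im_quadratic_ge_of_expansion hC hexp him
  have hBpos : ∀ v, v ≠ 0 → 0 < (B v v).im := fun v hv =>
    lt_of_lt_of_le (by positivity) (hB v)
  refine ⟨_, integral_cexp_quadratic_ne_zero μ B hBs hBpos, fun a A him' hA ha hmeas => ?_⟩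
  set d := Module.finrank ℝ E
  have hLO : (fun y => a y - (a 0 + fderiv ℝ a 0 y)) =O[𝓝 0] fun y => ‖y‖ ^ 2 := by
    have := ContDiffAt.taylor_isBigO (n := 1) (f := a) (x := 0) (by exact_mod_cast ha)
    simpa [Finset.sum_range_succ] using this
  set L := fderiv ℝ a 0
  obtain ⟨K', hK'⟩ := exists_norm_sub_expansion_le hK hC hexp hB him him' hA L hLO
  -- scaling
  have hscale : ∀ (F : Type) [NormedAddCommGroup F] [NormedSpace ℝ F] (f : E → F) (ε : ℝ), 0 < ε →
      ∫ y, f ((Real.sqrt ε)⁻¹ • y) ∂μ = (ε ^ ((d : ℝ) / 2)) • ∫ y, f y ∂μ := by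
    intro F _ _ f ε hε
    rw [Measure.integral_comp_smul]
    congr 1
    rw [inv_pow, inv_inv, abs_of_nonneg (by positivity), Real.sqrt_eq_rpow, ← Real.rpow_natCast,
      ← Real.rpow_mul hε.le]
    congr 1
    ring
  set W := ∫ z : E, (1 + ‖z‖) ^ 6 * Real.exp (-(c * ‖z‖ ^ 2)) ∂μ
  refine IsBigO.of_bound (3 * |K'| * W) ?_
  filter_upwards [self_mem_nhdsWithin] with ε hε
  have hε : 0 < ε := hε
  have hs : 0 < Real.sqrt ε := Real.sqrt_pos.2 hε
  have hs2 : Real.sqrt ε ^ 2 = ε := Real.sq_sqrt hε.le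
  -- the main terms
  have hi1 : Integrable (fun y => Complex.exp (Complex.I * (ε : ℂ)⁻¹ * B y y) * a 0) μ :=
    integrable_cexp_quadratic_mul μ B hc hB hε continuous_const (K := A) (k := 0)
      (fun y => by simpa using hA 0)
  have hi2 : Integrable (fun y => Complex.exp (Complex.I * (ε : ℂ)⁻¹ * B y y) *
      (L y + Complex.I * (ε : ℂ)⁻¹ * C y * a 0)) μ := by
    refine integrable_cexp_quadratic_mul μ B hc hB hε (by fun_prop)
      (K := ‖L‖ + ε⁻¹ * K * A) (k := 3) (fun y => ?_)
    have hy : ‖y‖ ≤ (1 + ‖y‖) ^ 3 :=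
      (by linarith : ‖y‖ ≤ 1 + ‖y‖).trans
        (le_self_pow₀ (by linarith [norm_nonneg y]) (by norm_num))
    have hy3 : ‖y‖ ^ 3 ≤ (1 + ‖y‖) ^ 3 := by gcongr; linarith
    calc _ ≤ ‖L y‖ + ‖Complex.I * (ε : ℂ)⁻¹ * C y * a 0‖ := norm_add_le _ _
      _ ≤ ‖L‖ * ‖y‖ + ε⁻¹ * (K * ‖y‖ ^ 3) * A := by
        rw [norm_mul, Complex.norm_I_mul_inv_mul hε]
        gcongr
        · exact L.le_opNorm y
        · exact hC y
        · exact hA 0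
      _ ≤ ‖L‖ * (1 + ‖y‖) ^ 3 + ε⁻¹ * (K * (1 + ‖y‖) ^ 3) * A := by
        have := (norm_nonneg _).trans (hA 0)
        gcongr
      _ = _ := by ring
  -- `B` is even while `L` and `C` are odd. This parity is why the error gains a full power of `ε`
  -- and not only `√ε`.
  have hodd : ∫ y, Complex.exp (Complex.I * (ε : ℂ)⁻¹ * B y y) *
      (L y + Complex.I * (ε : ℂ)⁻¹ * C y * a 0) ∂μ = 0 := by
    have h := integral_neg_eq_self (fun y => Complex.exp (Complex.I * (ε : ℂ)⁻¹ * B y y) *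
      (L y + Complex.I * (ε : ℂ)⁻¹ * C y * a 0)) μ
    have h' : ∀ y, Complex.exp (Complex.I * (ε : ℂ)⁻¹ * B (-y) (-y)) *
        (L (-y) + Complex.I * (ε : ℂ)⁻¹ * C (-y) * a 0) =
        -(Complex.exp (Complex.I * (ε : ℂ)⁻¹ * B y y) *
          (L y + Complex.I * (ε : ℂ)⁻¹ * C y * a 0)) := by
      intro y
      rw [hCodd]
      simp only [map_neg, neg_apply, neg_neg]
      ring
    simp_rw [h', integral_neg] at h
    exact self_eq_neg.1 h.symm
  have hmain : ∫ y, Complex.exp (Complex.I * (ε : ℂ)⁻¹ * B y y) * a 0 ∂μ =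
      (∫ y, Complex.exp (Complex.I * B y y) ∂μ) * a 0 * ((ε ^ ((d : ℝ) / 2) : ℝ) : ℂ) := by
    rw [integral_mul_const]
    have h := hscale ℂ (fun y => Complex.exp (Complex.I * B y y)) ε hε
    have h' : ∀ y, Complex.exp (Complex.I * B ((Real.sqrt ε)⁻¹ • y) ((Real.sqrt ε)⁻¹ • y)) =
        Complex.exp (Complex.I * (ε : ℂ)⁻¹ * B y y) := by
      intro y
      simp only [map_smul, smul_apply, smul_smul]
      rw [← sq, inv_pow, hs2, Complex.real_smul]
      push_cast
      ring_nf
    simp_rw [h'] at h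
    rw [h, Complex.real_smul]
    ring
  set R : E → ℂ := fun y => Complex.exp (Complex.I * (ε : ℂ)⁻¹ * Ψ y) * a y -
        Complex.exp (Complex.I * (ε : ℂ)⁻¹ * B y y) *
          (a 0 + (L y + Complex.I * (ε : ℂ)⁻¹ * C y * a 0)) with hR
  -- With `y = √ε z`, the weight `‖y‖² + ‖y‖⁴/ε + ‖y‖⁶/ε²` equals `ε(‖z‖² + ‖z‖⁴ + ‖z‖⁶)`, and the
  -- Gaussian no longer depends on `ε`.
  have hRb : ∀ y, ‖R y‖ ≤ 3 * |K'| * ε * ((1 + ‖(Real.sqrt ε)⁻¹ • y‖) ^ 6 *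
      Real.exp (-(c * ‖(Real.sqrt ε)⁻¹ • y‖ ^ 2))) := by
    intro y
    refine (hK' ε hε y).trans ?_
    set z := (Real.sqrt ε)⁻¹ • y with hz
    have hyz : ‖y‖ = Real.sqrt ε * ‖z‖ := by
      rw [hz, norm_smul, norm_inv, Real.norm_of_nonneg hs.le]
      field_simp
    have h4 : Real.sqrt ε ^ 4 = ε ^ 2 := by rw [show 4 = 2 * 2 from rfl, pow_mul, hs2]
    have h6 : Real.sqrt ε ^ 6 = ε ^ 3 := by rw [show 6 = 2 * 3 from rfl, pow_mul, hs2]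
    have he : ‖y‖ ^ 2 + ε⁻¹ * ‖y‖ ^ 4 + ε⁻¹ ^ 2 * ‖y‖ ^ 6 =
        ε * (‖z‖ ^ 2 + ‖z‖ ^ 4 + ‖z‖ ^ 6) := by
      rw [hyz, mul_pow, mul_pow, mul_pow, h4, h6, hs2]
      field_simp
    have he2 : ε⁻¹ * (c * ‖y‖ ^ 2) = c * ‖z‖ ^ 2 := by
      rw [hyz, mul_pow, hs2]; field_simp
    rw [he, he2]
    have hz1 : 1 ≤ 1 + ‖z‖ := by linarith [norm_nonneg z]
    have hp : ∀ k, k ≤ 6 → ‖z‖ ^ k ≤ (1 + ‖z‖) ^ 6 := fun k hk =>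
      (pow_le_pow_left₀ (norm_nonneg z) (by linarith) k).trans (pow_le_pow_right₀ hz1 hk)
    have hsum : ‖z‖ ^ 2 + ‖z‖ ^ 4 + ‖z‖ ^ 6 ≤ 3 * (1 + ‖z‖) ^ 6 := by
      linarith [hp 2 (by norm_num), hp 4 (by norm_num), hp 6 (by norm_num)]
    calc _ ≤ |K'| * (ε * (3 * (1 + ‖z‖) ^ 6)) * Real.exp (-(c * ‖z‖ ^ 2)) := by
          gcongr
          exact le_abs_self _
      _ = _ := by ring
  have hbi : Integrable (fun y : E => 3 * |K'| * ε * ((1 + ‖(Real.sqrt ε)⁻¹ • y‖) ^ 6 *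
      Real.exp (-(c * ‖(Real.sqrt ε)⁻¹ • y‖ ^ 2)))) μ :=
    (((integrable_one_add_norm_pow_mul_exp μ hc 6).comp_smul (inv_ne_zero hs.ne'))).const_mul _
  have hi12 : Integrable (fun y => Complex.exp (Complex.I * (ε : ℂ)⁻¹ * B y y) *
      (a 0 + (L y + Complex.I * (ε : ℂ)⁻¹ * C y * a 0))) μ := by
    simp_rw [mul_add (Complex.exp _) (a 0)]
    exact hi1.add hi2
  have hRi : Integrable R μ :=
    hbi.mono' ((hmeas ε hε).sub hi12.aestronglyMeasurable) (Eventually.of_forall hRb)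
  have hsplit : ∫ y, Complex.exp (Complex.I * (ε : ℂ)⁻¹ * Ψ y) * a y ∂μ =
      ∫ y, R y ∂μ + (∫ y, Complex.exp (Complex.I * B y y) ∂μ) * a 0 *
        ((ε ^ ((d : ℝ) / 2) : ℝ) : ℂ) := by
    have h12 : ∫ y, Complex.exp (Complex.I * (ε : ℂ)⁻¹ * B y y) *
        (a 0 + (L y + Complex.I * (ε : ℂ)⁻¹ * C y * a 0)) ∂μ =
        (∫ y, Complex.exp (Complex.I * B y y) ∂μ) * a 0 * ((ε ^ ((d : ℝ) / 2) : ℝ) : ℂ) := by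
      simp_rw [mul_add (Complex.exp _) (a 0)]
      rw [integral_add hi1 hi2, hodd, add_zero, hmain]
    rw [← h12, ← integral_add hRi hi12]
    refine integral_congr_ae (Eventually.of_forall fun y => ?_)
    simp [hR]
  rw [hsplit, add_sub_cancel_right]
  refine (norm_integral_le_of_norm_le hbi (Eventually.of_forall hRb)).trans (le_of_eq ?_)
  rw [integral_const_mul, hscale ℝ (fun z => (1 + ‖z‖) ^ 6 * Real.exp (-(c * ‖z‖ ^ 2))) ε hε,
    Real.norm_of_nonneg (by positivity), Real.rpow_add hε, Real.rpow_one, smul_eq_mul]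
  ring

end Laplace

/-! ### Graph charts of the boundary. -/

/-- A graph chart of the hypersurface `S` over the open set `O`: a smooth parametrization `φ` of
`S ∩ O` by the open set `U` whose inverse is the restriction of a globally smooth map `π`. -/
structure IsGraphChart {n : ℕ} (S O : Set (EuclideanSpace ℝ (Fin n)))
    (U : Set (EuclideanSpace ℝ (Fin (n - 1))))
    (φ : EuclideanSpace ℝ (Fin (n - 1)) → EuclideanSpace ℝ (Fin n))
    (π : EuclideanSpace ℝ (Fin n) → EuclideanSpace ℝ (Fin (n - 1))) : Prop where
  isOpen_target : IsOpen O
  isOpen_source : IsOpen U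
  smooth : ContDiffOn ℝ ∞ φ U
  smooth_proj : ContDiff ℝ ∞ π
  mapsTo : ∀ a ∈ U, φ a ∈ S ∩ O
  proj_mem : ∀ x ∈ S ∩ O, π x ∈ U
  right_inv : ∀ x ∈ S ∩ O, φ (π x) = x
  left_inv : ∀ a ∈ U, π (φ a) = a

/-- Where `ρ > 0` the point is interior by continuity. A zero of `ρ` interior to `M` would be a
local minimum of `ρ`, contradicting `dρ ≠ 0`. -/
theorem mem_frontier_iff_of_defining_function {E : Type*} [NormedAddCommGroup E] [NormedSpace ℝ E]
    {M W : Set E} {ρ : E → ℝ} (hM : IsClosed M) (hW : IsOpen W) (hρ : ContinuousOn ρ W)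
    (hMW : ∀ y ∈ W, (y ∈ M ↔ 0 ≤ ρ y)) {y : E} (hy : y ∈ W) (hd : fderiv ℝ ρ y ≠ 0) :
    y ∈ frontier M ↔ ρ y = 0 := by
  have hρy : ContinuousAt ρ y := hρ.continuousAt (hW.mem_nhds hy)
  rw [hM.frontier_eq, Set.mem_sdiff, hMW y hy, mem_interior_iff_mem_nhds]
  constructor
  · rintro ⟨h0, h1⟩
    by_contra hne
    refine h1 ?_
    filter_upwards [hρy.eventually_const_lt (lt_of_le_of_ne h0 (Ne.symm hne)), hW.mem_nhds hy]
      with z hz hzW using (hMW z hzW).2 hz.le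
  · intro h0
    refine ⟨h0.ge, fun h1 => hd ?_⟩
    refine IsLocalMin.fderiv_eq_zero ?_
    filter_upwards [h1, hW.mem_nhds hy] with z hz hzW
    rw [h0]
    exact (hMW z hzW).1 hz

/-- The inverse function theorem is applied to `F = (ρ, π)`, with `π` the affine projection along
`v` onto `ker dρ(x₀)`; the chart is the slice `ρ = 0` of the local inverse. An affine `π` is smooth
on all of `ℝⁿ`. -/
theorem exists_isGraphChart {n : ℕ} {M : Set (EuclideanSpace ℝ (Fin n))}
    (hM : IsCompactSmoothDomain M) {x₀ : EuclideanSpace ℝ (Fin n)} (hx₀ : x₀ ∈ frontier M) :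
    ∃ O U φ π, IsGraphChart (frontier M) O U φ π ∧ x₀ ∈ O ∧ π x₀ = 0 := by
  obtain ⟨W, ρ, hW, hxW, hρ, hd, hMW⟩ := hM.smooth_boundary x₀ hx₀
  have hMc : IsClosed M := hM.isCompact.isClosed
  set ℓ := fderiv ℝ ρ x₀ with hℓ
  obtain ⟨v₁, hv₁⟩ : ∃ v, ℓ v ≠ 0 := by
    by_contra! h
    exact hd (ContinuousLinearMap.ext h)
  set v := (ℓ v₁)⁻¹ • v₁ with hv
  have hℓv : ℓ v = 1 := by simp [hv, hv₁]
  have hker : Module.finrank ℝ (LinearMap.ker ℓ.toLinearMap) = n - 1 := by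
    have h := Module.Dual.finrank_ker_add_one_of_ne_zero (f := ℓ.toLinearMap)
      (fun h => hd (ContinuousLinearMap.coe_injective h))
    rw [finrank_euclideanSpace_fin] at h
    omega
  let e : LinearMap.ker ℓ.toLinearMap ≃L[ℝ] EuclideanSpace ℝ (Fin (n - 1)) :=
    ContinuousLinearEquiv.ofFinrankEq (by rw [hker, finrank_euclideanSpace_fin])
  let q : EuclideanSpace ℝ (Fin n) →L[ℝ] LinearMap.ker ℓ.toLinearMap :=
    (ContinuousLinearMap.id ℝ _ - ℓ.smulRight v).codRestrict _ (fun x => by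
      simp [hℓv])
  let P : EuclideanSpace ℝ (Fin n) →L[ℝ] EuclideanSpace ℝ (Fin (n - 1)) :=
    e.toContinuousLinearMap.comp q
  let F' : EuclideanSpace ℝ (Fin n) ≃L[ℝ] ℝ × EuclideanSpace ℝ (Fin (n - 1)) :=
    ContinuousLinearEquiv.equivOfInverse (ℓ.prod P)
      ((ContinuousLinearMap.fst ℝ ℝ _).smulRight v +
        (Submodule.subtypeL _).comp (e.symm.toContinuousLinearMap.comp
          (ContinuousLinearMap.snd ℝ ℝ _)))
      (fun x => by simp [P, q])
      (fun y => by
        have hk : ℓ (e.symm y.2 : EuclideanSpace ℝ (Fin n)) = 0 := (e.symm y.2).2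
        ext1
        · simp [hℓv, hk]
        · simp only [P, q]
          simp only [ContinuousLinearMap.prod_apply, ContinuousLinearMap.comp_apply]
          apply e.symm.injective
          ext1
          simp [hℓv, hk])
  set π : EuclideanSpace ℝ (Fin n) → EuclideanSpace ℝ (Fin (n - 1)) := fun x => P (x - x₀)
  have hπ : ContDiff ℝ ∞ π := P.contDiff.comp (contDiff_id.sub contDiff_const)
  set F : EuclideanSpace ℝ (Fin n) → ℝ × EuclideanSpace ℝ (Fin (n - 1)) := fun x => (ρ x, π x)
  have hFs : ∀ x ∈ W, ContDiffAt ℝ ∞ F x := fun x hx =>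
    (hρ.contDiffAt (hW.mem_nhds hx)).prodMk hπ.contDiffAt
  have hF' : HasFDerivAt F (F' : EuclideanSpace ℝ (Fin n) →L[ℝ] _) x₀ := by
    have h1 : HasFDerivAt ρ ℓ x₀ :=
      ((hρ.contDiffAt (hW.mem_nhds hxW)).differentiableAt (by simp)).hasFDerivAt
    have h2 : HasFDerivAt π P x₀ := by
      have h := P.hasFDerivAt.comp x₀ ((hasFDerivAt_id x₀).sub_const x₀)
      rwa [ContinuousLinearMap.comp_id] at h
    exact h1.prodMk h2
  have hfd : ContinuousAt (fderiv ℝ F) x₀ :=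
    ((hFs x₀ hxW).fderiv_right (m := 0) (by simp)).continuousAt
  have hρd : ContinuousAt (fderiv ℝ ρ) x₀ :=
    ((hρ.contDiffAt (hW.mem_nhds hxW)).fderiv_right (m := 0) (by simp)).continuousAt
  -- Both nondegeneracy conditions are open and must hold on the whole chart: `dρ ≠ 0` to identify
  -- the frontier with `ρ = 0`, and invertibility of `dF` to make the inverse smooth at every point.
  have hev : ∀ᶠ x in 𝓝 x₀, x ∈ W ∧ fderiv ℝ ρ x ≠ 0 ∧
      fderiv ℝ F x ∈ range ((↑) :
        (EuclideanSpace ℝ (Fin n) ≃L[ℝ] ℝ × EuclideanSpace ℝ (Fin (n - 1)))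
        → EuclideanSpace ℝ (Fin n) →L[ℝ] ℝ × EuclideanSpace ℝ (Fin (n - 1))) := by
    refine (show ∀ᶠ x in 𝓝 x₀, x ∈ W from hW.mem_nhds hxW).and ((hρd.eventually_ne hd).and ?_)
    refine hfd.eventually_mem ?_
    rw [hF'.fderiv]
    exact ContinuousLinearEquiv.nhds F'
  obtain ⟨O₁, hO₁, hO₁o, hxO₁⟩ := eventually_nhds_iff.1 hev
  let H := (hFs x₀ hxW).toOpenPartialHomeomorph F hF' (by simp)
  have hHF : ∀ x, H x = F x := fun x => rfl
  have hxs : x₀ ∈ H.source := (hFs x₀ hxW).mem_toOpenPartialHomeomorph_source hF' (by simp)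
  set O := H.source ∩ O₁
  set U := (fun a => ((0 : ℝ), a)) ⁻¹' (H.target ∩ H.symm ⁻¹' O₁)
  set φ : EuclideanSpace ℝ (Fin (n - 1)) → EuclideanSpace ℝ (Fin n) := fun a => H.symm (0, a)
  have hfront : ∀ x ∈ O, (x ∈ frontier M ↔ ρ x = 0) := fun x hx =>
    mem_frontier_iff_of_defining_function hMc hW hρ.continuousOn hMW (hO₁ x hx.2).1
      (hO₁ x hx.2).2.1
  have hφO : ∀ a ∈ U, φ a ∈ O := fun a ha => ⟨H.map_target ha.1, ha.2⟩
  have hFφ : ∀ a ∈ U, F (φ a) = (0, a) := fun a ha => by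
    rw [← hHF]; exact H.right_inv ha.1
  have hFx : ∀ x ∈ frontier M ∩ O, F x = (0, π x) := fun x hx => by
    have := (hfront x hx.2).1 hx.1
    simp [F, this]
  refine ⟨O, U, φ, π, ⟨H.open_source.inter hO₁o, ?_, ?_, hπ, ?_, ?_, ?_, ?_⟩, ⟨hxs, hxO₁⟩, ?_⟩
  · exact (H.symm.isOpen_inter_preimage hO₁o).preimage (by fun_prop)
  · intro a ha
    have hb := hO₁ _ (hφO a ha).2
    obtain ⟨f₀, hf₀⟩ := hb.2.2
    have hs : ContDiffAt ℝ ∞ H.symm (0, a) := by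
      refine H.contDiffAt_symm (f₀' := f₀) ha.1 ?_ (hFs _ hb.1)
      rw [hf₀]
      exact ((hFs _ hb.1).differentiableAt (by simp)).hasFDerivAt
    exact (hs.comp a (contDiffAt_const.prodMk contDiffAt_id)).contDiffWithinAt
  · intro a ha
    refine ⟨(hfront _ (hφO a ha)).2 ?_, hφO a ha⟩
    exact congrArg Prod.fst (hFφ a ha)
  · intro x hx
    have h1 : H x = (0, π x) := hFx x hx
    refine ⟨?_, ?_⟩
    · change (0, π x) ∈ H.target
      rw [← h1]; exact H.map_source hx.2.1
    · change H.symm (0, π x) ∈ O₁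
      rw [← h1, H.left_inv hx.2.1]
      exact hx.2.2
  · intro x hx
    have h1 : H x = (0, π x) := hFx x hx
    change H.symm (0, π x) = x
    rw [← h1, H.left_inv hx.2.1]
  · intro a ha
    exact congrArg Prod.snd (hFφ a ha)
  · simp [π]

section Surface

variable {n : ℕ}

namespace IsGraphChart

variable {S O : Set (EuclideanSpace ℝ (Fin n))} {U : Set (EuclideanSpace ℝ (Fin (n - 1)))}
  {φ : EuclideanSpace ℝ (Fin (n - 1)) → EuclideanSpace ℝ (Fin n)}
  {π : EuclideanSpace ℝ (Fin n) → EuclideanSpace ℝ (Fin (n - 1))}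

theorem differentiableAt (h : IsGraphChart S O U φ π) {a : EuclideanSpace ℝ (Fin (n - 1))}
    (ha : a ∈ U) : DifferentiableAt ℝ φ a :=
  (h.smooth.contDiffAt (h.isOpen_source.mem_nhds ha)).differentiableAt (by simp)

/-- Differentiating `π ∘ φ = id` exhibits a left inverse of the differential of `φ`. -/
theorem fderiv_injective (h : IsGraphChart S O U φ π) {a : EuclideanSpace ℝ (Fin (n - 1))}
    (ha : a ∈ U) : Function.Injective (fderiv ℝ φ a) := by
  have hc : HasFDerivAt (π ∘ φ) ((fderiv ℝ π (φ a)).comp (fderiv ℝ φ a)) a :=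
    ((h.smooth_proj.differentiable (by simp)) (φ a)).hasFDerivAt.comp a
      (h.differentiableAt ha).hasFDerivAt
  have hid : HasFDerivAt (π ∘ φ) (ContinuousLinearMap.id ℝ _) a := by
    refine (hasFDerivAt_id a).congr_of_eventuallyEq ?_
    filter_upwards [h.isOpen_source.mem_nhds ha] with b hb using h.left_inv b hb
  have heq := hc.unique hid
  intro v w hvw
  have hv := congrArg (fun f => f v) heq
  have hw := congrArg (fun f => f w) heq
  simp only [ContinuousLinearMap.comp_apply, ContinuousLinearMap.id_apply] at hv hw
  rw [← hv, hvw, hw]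

theorem isLocalParam (h : IsGraphChart S O U φ π) : IsLocalParam S U φ where
  isOpen := h.isOpen_source
  smooth := h.smooth
  injOn := fun a ha b hb hab => by rw [← h.left_inv a ha, hab, h.left_inv b hb]
  immersion := fun _ ha => h.fderiv_injective ha
  mapsTo := fun a ha => (h.mapsTo a ha).1

end IsGraphChart

/-! ### The surface measure in a chart. -/

theorem measurableSet_inter_preimage_of_continuousOn {α β : Type*} [TopologicalSpace α]
    [MeasurableSpace α] [BorelSpace α] [TopologicalSpace β] [MeasurableSpace β] [BorelSpace β]
    {f : α → β} {s : Set α} (hf : ContinuousOn f s) (hs : MeasurableSet s) {t : Set β}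
    (ht : MeasurableSet t) : MeasurableSet (s ∩ f ⁻¹' t) := by
  have h := hs.subtype_image ((continuousOn_iff_continuous_domRestrict.1 hf).measurable ht)
  convert h using 1
  ext x
  simp [and_comm]

theorem paramArea_apply (g : RiemannianMetric n) {U : Set (EuclideanSpace ℝ (Fin (n - 1)))}
    {φ : EuclideanSpace ℝ (Fin (n - 1)) → EuclideanSpace ℝ (Fin n)} (hU : IsOpen U)
    (hφ : ContinuousOn φ U) {A : Set (EuclideanSpace ℝ (Fin n))} (hA : MeasurableSet A) :
    paramArea g U φ A = ∫⁻ a in U ∩ φ ⁻¹' A,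
      ENNReal.ofReal (Real.sqrt (pullbackMatrix g φ a).det) := by
  have hm : AEMeasurable φ ((volume.restrict U).withDensity
      fun a => ENNReal.ofReal (Real.sqrt (pullbackMatrix g φ a).det)) :=
    (hφ.aemeasurable hU.measurableSet).mono_ac (withDensity_absolutelyContinuous _ _)
  rw [paramArea, Measure.map_apply_of_aemeasurable hm hA, withDensity_apply',
    Measure.restrict_restrict' hU.measurableSet, inter_comm]

/-- By the chain rule the two Gram matrices are congruent through the matrix of `κ`, so the area
density picks up exactly the Jacobian of the change of variables. -/
theorem pullbackMatrix_comp (g : RiemannianMetric n)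
    {φ ψ : EuclideanSpace ℝ (Fin (n - 1)) → EuclideanSpace ℝ (Fin n)}
    {a b : EuclideanSpace ℝ (Fin (n - 1))}
    (κ : EuclideanSpace ℝ (Fin (n - 1)) →L[ℝ] EuclideanSpace ℝ (Fin (n - 1)))
    (hval : φ b = ψ a) (hder : fderiv ℝ ψ a = (fderiv ℝ φ b).comp κ) :
    Real.sqrt (pullbackMatrix g ψ a).det =
      |κ.det| * Real.sqrt (pullbackMatrix g φ b).det := by
  set K : Matrix (Fin (n - 1)) (Fin (n - 1)) ℝ :=
    Matrix.of fun i j => κ (EuclideanSpace.single j 1) i with hK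
  have hKdet : K.det = κ.det := by
    have : K = LinearMap.toMatrix (EuclideanSpace.basisFun (Fin (n - 1)) ℝ).toBasis
        (EuclideanSpace.basisFun (Fin (n - 1)) ℝ).toBasis κ.toLinearMap := by
      ext i j
      simp [hK, LinearMap.toMatrix_apply]
    rw [this, LinearMap.det_toMatrix]
  have hκ : ∀ j, κ (EuclideanSpace.single j 1) = ∑ k, K k j • EuclideanSpace.single k (1 : ℝ) := by
    intro j
    ext i
    simp [hK, Finset.sum_apply, Pi.single_apply]
  have hmat : pullbackMatrix g ψ a = Kᵀ * pullbackMatrix g φ b * K := by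
    ext i j
    simp only [pullbackMatrix, Matrix.of_apply, Matrix.mul_apply, Matrix.transpose_apply, hder,
      ContinuousLinearMap.comp_apply, hκ, map_sum, map_smul, sum_apply, smul_apply, smul_eq_mul,
      hval, Finset.mul_sum, Finset.sum_mul]
    refine Finset.sum_congr rfl fun k _ => Finset.sum_congr rfl fun l _ => ?_
    ring
  rw [hmat, Matrix.det_mul, Matrix.det_mul, Matrix.det_transpose, hKdet,
    show κ.det * (pullbackMatrix g φ b).det * κ.det = κ.det ^ 2 * (pullbackMatrix g φ b).det by ring,
    Real.sqrt_mul (sq_nonneg _), Real.sqrt_sq_eq_abs]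

/-- The area of a local parametrization is, over the domain of a graph chart, at most the area of
that chart. -/
theorem IsLocalParam.paramArea_inter_le {S O : Set (EuclideanSpace ℝ (Fin n))}
    {U U' : Set (EuclideanSpace ℝ (Fin (n - 1)))}
    {φ ψ : EuclideanSpace ℝ (Fin (n - 1)) → EuclideanSpace ℝ (Fin n)}
    {π : EuclideanSpace ℝ (Fin n) → EuclideanSpace ℝ (Fin (n - 1))} (g : RiemannianMetric n)
    (hψ : IsLocalParam S U' ψ) (h : IsGraphChart S O U φ π)
    {A : Set (EuclideanSpace ℝ (Fin n))} (hA : MeasurableSet A) :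
    paramArea g U' ψ (A ∩ O) ≤ paramArea g U φ A := by
  have hOm := h.isOpen_target.measurableSet
  rw [paramArea_apply g hψ.isOpen hψ.smooth.continuousOn (hA.inter hOm),
    paramArea_apply g h.isOpen_source h.smooth.continuousOn hA]
  set s := U' ∩ ψ ⁻¹' (A ∩ O) with hs
  have hsm : MeasurableSet s := measurableSet_inter_preimage_of_continuousOn
    hψ.smooth.continuousOn hψ.isOpen.measurableSet (hA.inter hOm)
  have hSO : ∀ a ∈ s, ψ a ∈ S ∩ O := fun a ha => ⟨hψ.mapsTo ha.1, ha.2.2⟩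
  -- The transition map, differentiable because `π` is smooth on all of `ℝⁿ`. Its image may miss
  -- part of `U`, hence only an inequality.
  set κ := π ∘ ψ with hκ
  have hdψ : ∀ a ∈ s, DifferentiableAt ℝ ψ a := fun a ha =>
    (hψ.smooth.contDiffAt (hψ.isOpen.mem_nhds ha.1)).differentiableAt (by simp)
  have hdκ : ∀ a ∈ s, HasFDerivAt κ (fderiv ℝ κ a) a := fun a ha =>
    (((h.smooth_proj.differentiable (by simp)) (ψ a)).comp a (hdψ a ha)).hasFDerivAt
  have hder : ∀ a ∈ s, fderiv ℝ ψ a = (fderiv ℝ φ (κ a)).comp (fderiv ℝ κ a) := by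
    intro a ha
    have hκU : κ a ∈ U := h.proj_mem _ (hSO a ha)
    have h1 := (h.differentiableAt hκU).hasFDerivAt.comp a (hdκ a ha)
    have h2 : ψ =ᶠ[𝓝 a] φ ∘ κ := by
      have hopen := hψ.smooth.continuousOn.isOpen_inter_preimage hψ.isOpen h.isOpen_target
      filter_upwards [hopen.mem_nhds ⟨ha.1, ha.2.2⟩] with b hb
      exact (h.right_inv _ ⟨hψ.mapsTo hb.1, hb.2⟩).symm
    exact (h1.congr_of_eventuallyEq h2).fderiv
  have hinj : InjOn κ s := by
    intro a ha b hb hab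
    refine hψ.injOn ha.1 hb.1 ?_
    rw [← h.right_inv _ (hSO a ha), ← h.right_inv _ (hSO b hb)]
    exact congrArg φ hab
  have hval : ∀ a ∈ s, φ (κ a) = ψ a := fun a ha => h.right_inv _ (hSO a ha)
  calc ∫⁻ a in s, ENNReal.ofReal (Real.sqrt (pullbackMatrix g ψ a).det)
      = ∫⁻ a in s, ENNReal.ofReal |(fderiv ℝ κ a).det| *
          ENNReal.ofReal (Real.sqrt (pullbackMatrix g φ (κ a)).det) := by
        refine setLIntegral_congr_fun hsm fun a ha => ?_
        rw [← ENNReal.ofReal_mul (abs_nonneg _),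
          pullbackMatrix_comp g (fderiv ℝ κ a) (hval a ha) (hder a ha)]
    _ = ∫⁻ b in κ '' s, ENNReal.ofReal (Real.sqrt (pullbackMatrix g φ b).det) :=
        (lintegral_image_eq_lintegral_abs_det_fderiv_mul volume hsm
          (fun a ha => (hdκ a ha).hasFDerivWithinAt) hinj
          fun b => ENNReal.ofReal (Real.sqrt (pullbackMatrix g φ b).det)).symm
    _ ≤ _ := by
        refine lintegral_mono_set ?_
        rintro _ ⟨a, ha, rfl⟩
        refine ⟨h.proj_mem _ (hSO a ha), ?_⟩
        rw [mem_preimage, hval a ha]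
        exact ha.2.1

/-- Over the domain of a graph chart the surface measure is the area of that chart. -/
theorem IsGraphChart.surfaceMeasure_restrict {S O : Set (EuclideanSpace ℝ (Fin n))}
    {U : Set (EuclideanSpace ℝ (Fin (n - 1)))}
    {φ : EuclideanSpace ℝ (Fin (n - 1)) → EuclideanSpace ℝ (Fin n)}
    {π : EuclideanSpace ℝ (Fin n) → EuclideanSpace ℝ (Fin (n - 1))} (g : RiemannianMetric n)
    (h : IsGraphChart S O U φ π) :
    (surfaceMeasure g S).restrict O = paramArea g U φ := by
  have hOm := h.isOpen_target.measurableSet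
  have hzero : paramArea g U φ Oᶜ = 0 := by
    rw [paramArea_apply g h.isOpen_source h.smooth.continuousOn hOm.compl]
    have : U ∩ φ ⁻¹' Oᶜ = ∅ := by
      ext a
      simp only [mem_inter_iff, mem_preimage, mem_compl_iff, mem_empty_iff_false, iff_false,
        not_and, not_not]
      exact fun ha => (h.mapsTo a ha).2
    rw [this]
    simp
  have hself : (paramArea g U φ).restrict O = paramArea g U φ := by
    refine Measure.restrict_eq_self_of_ae_mem ?_
    exact hzero
  refine le_antisymm ?_ ?_
  -- Adding the top measure off `O` yields an upper bound for the area of every parametrization,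
  -- hence for their supremum; restriction to `O` removes the added term.
  · have hle : surfaceMeasure g S ≤ paramArea g U φ + (⊤ : Measure _).restrict Oᶜ := by
      refine sSup_le ?_
      rintro μ ⟨U', ψ, hψ, rfl⟩
      refine Measure.le_iff.2 fun A hA => ?_
      rw [Measure.add_apply, Measure.restrict_apply hA,
        ← measure_inter_add_sdiff A hOm]
      exact add_le_add (hψ.paramArea_inter_le g h hA)
        ((le_top : paramArea g U' ψ ≤ ⊤) _)
    calc (surfaceMeasure g S).restrict O
        ≤ (paramArea g U φ + (⊤ : Measure _).restrict Oᶜ).restrict O :=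
          Measure.restrict_mono_measure hle O
      _ = paramArea g U φ := by
          rw [Measure.restrict_add, hself, Measure.restrict_restrict hOm, inter_compl_self,
            Measure.restrict_empty, add_zero]
  · rw [← hself]
    exact Measure.restrict_mono_measure (le_sSup (show paramArea g U φ ∈
      {μ | ∃ U φ, IsLocalParam S U φ ∧ μ = paramArea g U φ} from ⟨U, φ, h.isLocalParam, rfl⟩)) O

/-! ### Second order behaviour at a critical zero. -/

section Critical

variable {E : Type*} [NormedAddCommGroup E] [NormedSpace ℝ E]

theorem ContDiffAt.quadratic_isBigO {f : E → ℝ} {x : E} (hf : ContDiffAt ℝ 3 f x) (h0 : f x = 0)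
    (h1 : fderiv ℝ f x = 0) :
    (fun y => f (x + y) - (1 / 2) * fderiv ℝ (fderiv ℝ f) x y y) =O[𝓝 0] fun y => ‖y‖ ^ 3 := by
  have h := ContDiffAt.taylor_isBigO (n := 2) (f := f) (x := x) (by exact_mod_cast hf)
  simpa [Finset.sum_range_succ, iteratedFDeriv_two_apply, h0, h1] using h

/-- Only the initial velocity `v₀` matters at second order, so the increment need not be a ray; this
allows curves lying in the boundary. -/
theorem tendsto_div_sq_of_critical {f : E → ℝ} {x : E} (hf : ContDiffAt ℝ 3 f x) (h0 : f x = 0)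
    (h1 : fderiv ℝ f x = 0) {v : ℝ → E} {v₀ : E}
    (hv : Tendsto (fun s => s⁻¹ • v s) (𝓝[>] 0) (𝓝 v₀)) :
    Tendsto (fun s => f (x + v s) / s ^ 2) (𝓝[>] 0)
      (𝓝 ((1 / 2) * fderiv ℝ (fderiv ℝ f) x v₀ v₀)) := by
  set D := fderiv ℝ (fderiv ℝ f) x
  obtain ⟨K, hK⟩ := (hf.quadratic_isBigO h0 h1).bound
  have hs0 : Tendsto (fun s : ℝ => s) (𝓝[>] 0) (𝓝 0) := tendsto_id.mono_left nhdsWithin_le_nhds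
  have hv0 : Tendsto v (𝓝[>] 0) (𝓝 0) := by
    have h := hs0.smul hv
    rw [zero_smul] at h
    refine h.congr' ?_
    filter_upwards [self_mem_nhdsWithin] with s hs
    rw [smul_smul, mul_inv_cancel₀ (ne_of_gt hs), one_smul]
  have hD : Tendsto (fun s => (1 / 2) * D (s⁻¹ • v s) (s⁻¹ • v s)) (𝓝[>] 0)
      (𝓝 ((1 / 2) * D v₀ v₀)) := by
    have hc : Continuous fun y => (1 / 2) * D y y := by fun_prop
    exact (hc.tendsto v₀).comp hv
  have hr : Tendsto (fun s => f (x + v s) / s ^ 2 - (1 / 2) * D (s⁻¹ • v s) (s⁻¹ • v s))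
      (𝓝[>] 0) (𝓝 0) := by
    have hb : Tendsto (fun s => K * (s * ‖s⁻¹ • v s‖ ^ 3)) (𝓝[>] 0) (𝓝 (K * (0 * ‖v₀‖ ^ 3))) :=
      (hs0.mul (hv.norm.pow 3)).const_mul K
    simp only [zero_mul, mul_zero] at hb
    refine squeeze_zero_norm' ?_ hb
    filter_upwards [self_mem_nhdsWithin, hv0.eventually hK] with s hs h
    have hs : 0 < s := hs
    have h2 : f (x + v s) / s ^ 2 - (1 / 2) * D (s⁻¹ • v s) (s⁻¹ • v s) =
        (f (x + v s) - (1 / 2) * D (v s) (v s)) / s ^ 2 := by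
      simp only [map_smul, smul_apply, smul_eq_mul]
      field_simp
    rw [h2, norm_div, Real.norm_of_nonneg (sq_nonneg s), div_le_iff₀ (by positivity)]
    refine h.trans (le_of_eq ?_)
    rw [norm_smul, norm_inv, Real.norm_of_nonneg hs.le, Real.norm_of_nonneg (by positivity)]
    field_simp
  have := hr.add hD
  simpa using this

theorem exists_mul_sq_le_of_pos [FiniteDimensional ℝ E] (D : E →L[ℝ] E →L[ℝ] ℝ)
    (hpos : ∀ v, v ≠ 0 → 0 < D v v) : ∃ c > 0, ∀ v, c * ‖v‖ ^ 2 ≤ D v v := by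
  rcases subsingleton_or_nontrivial E with hE | hE
  · exact ⟨1, one_pos, fun v => by simp [Subsingleton.elim v 0]⟩
  have hne : (Metric.sphere (0 : E) 1).Nonempty := NormedSpace.sphere_nonempty.2 zero_le_one
  obtain ⟨v₀, hv₀, hmin⟩ := (isCompact_sphere (0 : E) 1).exists_isMinOn hne
    (f := fun v => D v v) (by fun_prop)
  have hv₀' : v₀ ≠ 0 := by
    rintro rfl
    simp at hv₀
  refine ⟨D v₀ v₀, hpos v₀ hv₀', fun v => ?_⟩
  rcases eq_or_ne v 0 with rfl | hv
  · simp
  have hn : 0 < ‖v‖ := norm_pos_iff.2 hv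
  have h := hmin (show ‖v‖⁻¹ • v ∈ Metric.sphere (0 : E) 1 by
    rw [mem_sphere_zero_iff_norm, norm_smul, norm_inv, norm_norm, inv_mul_cancel₀ hn.ne'])
  simp only [mem_ofPred_eq, map_smul, smul_apply, smul_eq_mul] at h
  calc D v₀ v₀ * ‖v‖ ^ 2 ≤ (‖v‖⁻¹ * (‖v‖⁻¹ * D v v)) * ‖v‖ ^ 2 := by gcongr
    _ = D v v := by field_simp

/-- A function with a critical zero and positive second order behaviour along rays is bounded
below by a multiple of the squared distance. -/
theorem eventually_mul_sq_le_of_critical [FiniteDimensional ℝ E] {f : E → ℝ}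
    (hf : ContDiffAt ℝ 3 f 0) (h0 : f 0 = 0) (h1 : fderiv ℝ f 0 = 0)
    (hpos : ∀ y, y ≠ 0 → ∃ l > 0, Tendsto (fun s : ℝ => f (s • y) / s ^ 2) (𝓝[>] 0) (𝓝 l)) :
    ∃ c > 0, ∀ᶠ y in 𝓝 0, c * ‖y‖ ^ 2 ≤ f y := by
  have hDpos : ∀ y, y ≠ 0 → 0 < fderiv ℝ (fderiv ℝ f) 0 y y := by
    intro y hy
    obtain ⟨l, hl, hlim⟩ := hpos y hy
    have h := tendsto_div_sq_of_critical hf h0 h1 (v := fun s => s • y) (v₀ := y) (by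
      refine tendsto_const_nhds.congr' ?_
      filter_upwards [self_mem_nhdsWithin] with s hs
      rw [smul_smul, inv_mul_cancel₀ (ne_of_gt hs), one_smul])
    simp only [zero_add] at h
    have := tendsto_nhds_unique h hlim
    linarith
  obtain ⟨c, hc, hcD⟩ := exists_mul_sq_le_of_pos _ hDpos
  obtain ⟨K, hK⟩ := (hf.quadratic_isBigO h0 h1).bound
  -- Half of the Hessian gives `c/2`, and the cubic remainder costs at most `c/4` near the origin.
  refine ⟨c / 4, by positivity, ?_⟩
  have hsmall : ∀ᶠ y : E in 𝓝 0, |K| * ‖y‖ < c / 4 := by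
    have hcont : Continuous fun y : E => |K| * ‖y‖ := by fun_prop
    have := hcont.tendsto 0
    simp only [norm_zero, mul_zero] at this
    exact this.eventually_lt_const (by positivity)
  filter_upwards [hK, hsmall] with y hy hs
  rw [zero_add, Real.norm_of_nonneg (by positivity : (0 : ℝ) ≤ ‖y‖ ^ 3)] at hy
  have h2 := (abs_le.1 hy).1
  have h3 := hcD y
  have h4 : K * ‖y‖ ^ 3 ≤ c / 4 * ‖y‖ ^ 2 := by
    calc K * ‖y‖ ^ 3 ≤ |K| * ‖y‖ ^ 3 := by gcongr; exact le_abs_self _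
      _ = (|K| * ‖y‖) * ‖y‖ ^ 2 := by ring
      _ ≤ _ := by gcongr
  linarith

end Critical

/-! ### Beam phases along their paths. -/

theorem quadForm_smul (H : Matrix (Fin n) (Fin n) ℂ) (s : ℝ) (z : EuclideanSpace ℝ (Fin n)) :
    quadForm H (s • z) = (s : ℂ) ^ 2 * quadForm H z := by
  simp only [quadForm, Finset.mul_sum, PiLp.smul_apply, smul_eq_mul, Complex.ofReal_mul]
  refine Finset.sum_congr rfl fun j _ => Finset.sum_congr rfl fun k _ => ?_
  ring

theorem exists_norm_quadForm_le (H : Matrix (Fin n) (Fin n) ℂ) :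
    ∃ K : ℝ, ∀ z, ‖quadForm H z‖ ≤ K * ‖z‖ ^ 2 := by
  refine ⟨∑ j, ∑ k, ‖H j k‖, fun z => ?_⟩
  rw [quadForm, Finset.sum_mul]
  refine (norm_sum_le _ _).trans (Finset.sum_le_sum fun j _ => ?_)
  rw [Finset.sum_mul]
  refine (norm_sum_le _ _).trans (Finset.sum_le_sum fun k _ => ?_)
  rw [norm_mul, norm_mul, Complex.norm_real, Complex.norm_real]
  calc _ ≤ ‖z‖ * ‖H j k‖ * ‖z‖ := by
        gcongr
        · exact PiLp.norm_apply_le z j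
        · exact PiLp.norm_apply_le z k
    _ = _ := by ring

theorem im_quadForm_pos {H : Matrix (Fin n) (Fin n) ℂ} (hH : (H.map Complex.im).PosDef)
    {z : EuclideanSpace ℝ (Fin n)} (hz : z ≠ 0) : 0 < (quadForm H z).im := by
  have hz' : z.ofLp ≠ 0 := fun h => hz (by ext i; simp [h])
  have h := hH.dotProduct_mulVec_pos hz'
  have heq : (quadForm H z).im = star z.ofLp ⬝ᵥ H.map Complex.im *ᵥ z.ofLp := by
    simp only [quadForm, Complex.im_sum, dotProduct, Matrix.mulVec, Finset.mul_sum,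
      Matrix.map_apply, Pi.star_apply, star_trivial]
    refine Finset.sum_congr rfl fun j _ => Finset.sum_congr rfl fun k _ => ?_
    simp only [Complex.mul_im, Complex.mul_re, Complex.ofReal_re, Complex.ofReal_im]
    ring
  rw [heq]
  exact h

namespace IsBeamPhase

variable {T : ℝ} {θ : ℝ × EuclideanSpace ℝ (Fin n) → ℂ} {γ : ℝ → EuclideanSpace ℝ (Fin n)}
  {p : ℝ → EuclideanSpace ℝ (Fin n) →L[ℝ] ℝ} {H : ℝ → Matrix (Fin n) (Fin n) ℂ}

theorem contDiffAt (h : IsBeamPhase T θ γ p H) {q : ℝ × EuclideanSpace ℝ (Fin n)}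
    (hq : q.1 ∈ Ioo 0 T) : ContDiffAt ℝ ∞ θ q :=
  h.smooth_phase.contDiffAt ((isOpen_Ioo.prod isOpen_univ).mem_nhds ⟨hq, mem_univ _⟩)

theorem hasDerivAt_path (h : IsBeamPhase T θ γ p H) {t : ℝ} (ht : t ∈ Ioo 0 T) :
    HasDerivAt γ (deriv γ t) t :=
  ((h.smooth_path.contDiffAt (isOpen_Ioo.mem_nhds ht)).differentiableAt (by simp)).hasDerivAt

theorem apply_path (h : IsBeamPhase T θ γ p H) {t : ℝ} (ht : t ∈ Ioo 0 T) : θ (t, γ t) = 0 := by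
  obtain ⟨K, hK⟩ := (h.expansion t ht).bound
  have := hK.self_of_nhds
  simpa [quadForm] using this

/-- The expansion gives the spatial differential `p t`, and `θ` is constantly zero along the path,
so `(1, γ̇)` is in the kernel. These two facts determine the differential. -/
theorem fderiv_apply (h : IsBeamPhase T θ γ p H) {t : ℝ} (ht : t ∈ Ioo 0 T) (τ : ℝ)
    (z : EuclideanSpace ℝ (Fin n)) :
    fderiv ℝ θ (t, γ t) (τ, z) = ((p t (z - τ • deriv γ t) : ℝ) : ℂ) := by
  have hθ : HasFDerivAt θ (fderiv ℝ θ (t, γ t)) (t, γ t) :=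
    ((h.contDiffAt (q := (t, γ t)) ht).differentiableAt (by simp)).hasFDerivAt
  have hx : ∀ z, fderiv ℝ θ (t, γ t) (0, z) = ((p t z : ℝ) : ℂ) := by
    have h1 : HasFDerivAt (fun x => θ (t, x))
        ((fderiv ℝ θ (t, γ t)).comp (ContinuousLinearMap.inr ℝ ℝ _)) (γ t) :=
      HasFDerivAt.comp (f := fun x => (t, x)) (γ t) hθ (hasFDerivAt_prodMk_right t (γ t))
    have h2 : HasFDerivAt (fun x => θ (t, x)) (Complex.ofRealCLM.comp (p t)) (γ t) := by
      rw [hasFDerivAt_iff_isLittleO]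
      obtain ⟨K, hK⟩ := exists_norm_quadForm_le (H t)
      have hlo : ∀ k : ℕ, 1 < k → (fun x => ‖x - γ t‖ ^ k) =o[𝓝 (γ t)] fun x => x - γ t := by
        intro k hk
        have hsub : Tendsto (fun x => x - γ t) (𝓝 (γ t)) (𝓝 0) := by
          have : Continuous fun x => x - γ t := by fun_prop
          simpa using this.tendsto (γ t)
        exact (isLittleO_norm_pow_id hk).comp_tendsto hsub
      have e1 := (h.expansion t ht).trans_isLittleO (hlo 3 (by norm_num))
      have e2 : (fun x => (1 / 2 : ℂ) * quadForm (H t) (x - γ t)) =o[𝓝 (γ t)]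
          fun x => x - γ t := by
        refine IsBigO.trans_isLittleO (IsBigO.of_bound K (Eventually.of_forall fun x => ?_))
          (hlo 2 (by norm_num))
        rw [norm_mul, Real.norm_of_nonneg (by positivity)]
        refine le_trans ?_ (hK _)
        refine mul_le_of_le_one_left (norm_nonneg _) ?_
        norm_num
      refine (e1.add e2).congr_left fun x => ?_
      rw [h.apply_path ht]
      simp only [sub_zero, ContinuousLinearMap.comp_apply, Complex.ofRealCLM_apply]
      ring
    intro z
    have := congrArg (fun f => f z) (h1.unique h2)
    simpa using this
  have ht' : fderiv ℝ θ (t, γ t) (1, deriv γ t) = 0 := by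
    have h1 : HasDerivAt (fun s => θ (s, γ s)) (fderiv ℝ θ (t, γ t) (1, deriv γ t)) t :=
      HasFDerivAt.comp_hasDerivAt (f := fun s => (s, γ s)) t hθ
        ((hasDerivAt_id t).prodMk (h.hasDerivAt_path ht))
    have h2 : HasDerivAt (fun s => θ (s, γ s)) 0 t := by
      refine (hasDerivAt_const t (0 : ℂ)).congr_of_eventuallyEq ?_
      filter_upwards [isOpen_Ioo.mem_nhds ht] with s hs using h.apply_path hs
    exact h1.unique h2
  have hdec : ((τ, z) : ℝ × EuclideanSpace ℝ (Fin n)) =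
      τ • (1, deriv γ t) + (0, z - τ • deriv γ t) := by
    ext1 <;> simp
  rw [hdec, map_add, map_smul, ht', hx]
  simp

/-- Second order behaviour of the imaginary part of a beam phase along a curve. -/
theorem tendsto_im_div_sq (h : IsBeamPhase T θ γ p H) {t₀ : ℝ} (ht : t₀ ∈ Ioo 0 T)
    {v : ℝ → ℝ × EuclideanSpace ℝ (Fin n)} {τ : ℝ} {z : EuclideanSpace ℝ (Fin n)}
    (hv : Tendsto (fun s => s⁻¹ • v s) (𝓝[>] 0) (𝓝 (τ, z))) :
    Tendsto (fun s => (θ ((t₀, γ t₀) + v s)).im / s ^ 2) (𝓝[>] 0)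
      (𝓝 ((1 / 2) * (quadForm (H t₀) (z - τ • deriv γ t₀)).im)) := by
  set f : ℝ × EuclideanSpace ℝ (Fin n) → ℝ := fun q => (θ q).im with hf
  have hfs : ∀ q : ℝ × EuclideanSpace ℝ (Fin n), q.1 ∈ Ioo 0 T → ContDiffAt ℝ ∞ f q :=
    fun q hq => Complex.imCLM.contDiff.contDiffAt.comp q (h.contDiffAt hq)
  have hf0 : ∀ t ∈ Ioo 0 T, f (t, γ t) = 0 := fun t ht => by simp [hf, h.apply_path ht]
  have hf1 : ∀ t ∈ Ioo 0 T, fderiv ℝ f (t, γ t) = 0 := by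
    intro t ht
    have h1 : HasFDerivAt f (Complex.imCLM.comp (fderiv ℝ θ (t, γ t))) (t, γ t) :=
      Complex.imCLM.hasFDerivAt.comp (t, γ t)
        ((h.contDiffAt (q := (t, γ t)) ht).differentiableAt (by simp)).hasFDerivAt
    rw [h1.fderiv]
    refine ContinuousLinearMap.ext fun q => ?_
    obtain ⟨τ, z⟩ := q
    simp only [ContinuousLinearMap.comp_apply, h.fderiv_apply ht]
    simp
  set D := fderiv ℝ (fderiv ℝ f) (t₀, γ t₀) with hD
  have hsymm : ∀ v w, D v w = D w v := fun v w =>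
    ((hfs (t₀, γ t₀) ht).isSymmSndFDerivAt (by
      rw [minSmoothness_of_isRCLikeNormedField]
      exact WithTop.coe_le_coe.2 (le_top (a := (2 : ℕ∞))))).eq v w
  -- The differential of `Im θ` vanishes along the whole path; its derivative in time is the Hessian
  -- applied to `(1, γ̇)`.
  have hDγ : D (1, deriv γ t₀) = 0 := by
    have hdd : HasFDerivAt (fderiv ℝ f) D (t₀, γ t₀) :=
      (((hfs (t₀, γ t₀) ht).fderiv_right (m := 1)
        (WithTop.coe_le_coe.2 (le_top (a := (1 + 1 : ℕ∞))))).differentiableAt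
        (by simp)).hasFDerivAt
    have h1 : HasDerivAt (fun s => fderiv ℝ f (s, γ s)) (D (1, deriv γ t₀)) t₀ :=
      HasFDerivAt.comp_hasDerivAt (f := fun s => (s, γ s)) t₀ hdd
        ((hasDerivAt_id t₀).prodMk (h.hasDerivAt_path ht))
    have h2 : HasDerivAt (fun s => fderiv ℝ f (s, γ s)) 0 t₀ := by
      refine (hasDerivAt_const t₀
        (0 : ℝ × EuclideanSpace ℝ (Fin n) →L[ℝ] ℝ)).congr_of_eventuallyEq ?_
      filter_upwards [isOpen_Ioo.mem_nhds ht] with s hs using hf1 s hs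
    exact h1.unique h2
  have hf3 : ContDiffAt ℝ 3 f (t₀, γ t₀) := (hfs (t₀, γ t₀) ht).of_le
    (WithTop.coe_le_coe.2 (le_top (a := (3 : ℕ∞))))
  -- The Hessian in spatial directions is read off from the expansion at the fixed time `t₀`, so no
  -- regularity of `H` in time enters.
  have hH : ∀ w, (1 / 2) * D (0, w) (0, w) = (1 / 2) * (quadForm (H t₀) w).im := by
    intro w
    have hlim := tendsto_div_sq_of_critical hf3 (hf0 t₀ ht) (hf1 t₀ ht)
      (v := fun s => s • (0, w)) (v₀ := (0, w)) (by
        refine tendsto_const_nhds.congr' ?_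
        filter_upwards [self_mem_nhdsWithin] with s hs
        rw [smul_smul, inv_mul_cancel₀ (ne_of_gt hs), one_smul])
    refine tendsto_nhds_unique hlim ?_
    obtain ⟨K, hK⟩ := (h.expansion t₀ ht).bound
    have hs0 : Tendsto (fun s : ℝ => s) (𝓝[>] 0) (𝓝 0) := tendsto_id.mono_left nhdsWithin_le_nhds
    have hcurve : Tendsto (fun s : ℝ => γ t₀ + s • w) (𝓝[>] 0) (𝓝 (γ t₀)) := by
      have : Continuous fun s : ℝ => γ t₀ + s • w := by fun_prop
      have := this.tendsto 0
      rw [zero_smul, add_zero] at this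
      exact this.mono_left nhdsWithin_le_nhds
    have hb : Tendsto (fun s : ℝ => K * (s * ‖w‖ ^ 3)) (𝓝[>] 0) (𝓝 (K * (0 * ‖w‖ ^ 3))) :=
      (hs0.mul_const _).const_mul K
    simp only [zero_mul, mul_zero] at hb
    rw [tendsto_iff_norm_sub_tendsto_zero]
    refine squeeze_zero' (Eventually.of_forall fun s => norm_nonneg _) ?_ hb
    filter_upwards [self_mem_nhdsWithin, hcurve.eventually hK] with s hs hsK
    have hs : 0 < s := hs
    simp only [add_sub_cancel_left, quadForm_smul] at hsK
    have h2 := (Complex.abs_im_le_norm _).trans hsK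
    have h3 : (θ (t₀, γ t₀ + s • w) -
        (((p t₀ (s • w) : ℝ) : ℂ) + (1 / 2 : ℂ) * ((s : ℂ) ^ 2 * quadForm (H t₀) w))).im =
        f (t₀, γ t₀ + s • w) - s ^ 2 * ((1 / 2) * (quadForm (H t₀) w).im) := by
      have : (1 / 2 : ℂ) * ((s : ℂ) ^ 2 * quadForm (H t₀) w) =
          ((1 / 2 * s ^ 2 : ℝ) : ℂ) * quadForm (H t₀) w := by push_cast; ring
      rw [this, Complex.sub_im, Complex.add_im, Complex.ofReal_im, Complex.im_ofReal_mul]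
      simp only [hf]
      ring
    rw [h3] at h2
    have h4 : (t₀, γ t₀) + s • ((0 : ℝ), w) = (t₀, γ t₀ + s • w) := by simp
    rw [h4, Real.norm_eq_abs]
    have h5 : f (t₀, γ t₀ + s • w) / s ^ 2 - (1 / 2) * (quadForm (H t₀) w).im =
        (f (t₀, γ t₀ + s • w) - s ^ 2 * ((1 / 2) * (quadForm (H t₀) w).im)) / s ^ 2 := by
      field_simp
    rw [h5, abs_div, abs_of_pos (by positivity : 0 < s ^ 2), div_le_iff₀ (by positivity)]
    refine h2.trans (le_of_eq ?_)
    rw [Real.norm_of_nonneg (by positivity), norm_smul, Real.norm_of_nonneg hs.le]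
    ring
  have hDτ : D (τ, z) (τ, z) = D (0, z - τ • deriv γ t₀) (0, z - τ • deriv γ t₀) := by
    have hdec : ((τ, z) : ℝ × EuclideanSpace ℝ (Fin n)) =
        τ • (1, deriv γ t₀) + (0, z - τ • deriv γ t₀) := by
      ext1 <;> simp
    have hDγ' : ∀ v, D v (1, deriv γ t₀) = 0 := fun v => by rw [hsymm, hDγ]; simp
    rw [hdec]
    simp only [map_add, map_smul, add_apply, smul_apply, hDγ, hDγ']
    simp
  rw [← hH, ← hDτ]
  exact tendsto_div_sq_of_critical hf3 (hf0 t₀ ht) (hf1 t₀ ht) hv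

end IsBeamPhase

/-! ### Area density, integration and tangent vectors in a graph chart. -/

namespace IsGraphChart

variable {S O : Set (EuclideanSpace ℝ (Fin n))} {U : Set (EuclideanSpace ℝ (Fin (n - 1)))}
  {φ : EuclideanSpace ℝ (Fin (n - 1)) → EuclideanSpace ℝ (Fin n)}
  {π : EuclideanSpace ℝ (Fin n) → EuclideanSpace ℝ (Fin (n - 1))}

theorem det_pullbackMatrix_pos (g : RiemannianMetric n) (h : IsGraphChart S O U φ π)
    {a : EuclideanSpace ℝ (Fin (n - 1))} (ha : a ∈ U) : 0 < (pullbackMatrix g φ a).det := by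
  refine Matrix.PosDef.det_pos (Matrix.PosDef.of_dotProduct_mulVec_pos ?_ fun x hx => ?_)
  · ext i j
    simp [pullbackMatrix, g.symm (φ a) (fderiv ℝ φ a (EuclideanSpace.single j 1))]
  · set w : EuclideanSpace ℝ (Fin (n - 1)) := WithLp.toLp 2 x with hw
    have hw0 : w ≠ 0 := fun h0 => hx (by simpa [hw] using h0)
    have hv : fderiv ℝ φ a w ≠ 0 := fun h0 =>
      hw0 (h.fderiv_injective ha (by rw [h0, map_zero]))
    have hsum : w = ∑ i, x i • EuclideanSpace.single i (1 : ℝ) := by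
      ext i
      simp [hw, Finset.sum_apply, Pi.single_apply]
    have hpos := g.pos (φ a) _ hv
    have heq : g.toFun (φ a) (fderiv ℝ φ a w) (fderiv ℝ φ a w) =
        star x ⬝ᵥ pullbackMatrix g φ a *ᵥ x := by
      rw [hsum]
      simp only [map_sum, map_smul, sum_apply, smul_apply, smul_eq_mul, dotProduct, Matrix.mulVec,
        Pi.star_apply, star_trivial, pullbackMatrix, Matrix.of_apply, Finset.mul_sum]
      rw [Finset.sum_comm]
      refine Finset.sum_congr rfl fun i _ => Finset.sum_congr rfl fun j _ => ?_
      ring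
    rw [← heq]
    exact hpos

theorem contDiffAt_sqrt_det (g : RiemannianMetric n) (h : IsGraphChart S O U φ π)
    {a : EuclideanSpace ℝ (Fin (n - 1))} (ha : a ∈ U) :
    ContDiffAt ℝ ∞ (fun b => Real.sqrt (pullbackMatrix g φ b).det) a := by
  have hφ : ContDiffAt ℝ ∞ φ a := h.smooth.contDiffAt (h.isOpen_source.mem_nhds ha)
  have hφ' : ContDiffAt ℝ ∞ (fderiv ℝ φ) a := hφ.fderiv_right (m := ∞) (by simp)
  refine ContDiffAt.sqrt ?_ (h.det_pullbackMatrix_pos g ha).ne'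
  simp only [Matrix.det_apply, pullbackMatrix, Matrix.of_apply]
  refine ContDiffAt.sum fun σ _ => ContDiffAt.const_smul _ (contDiffAt_prod fun i _ => ?_)
  exact ((g.smooth.contDiffAt.comp a hφ).clm_apply (hφ'.clm_apply contDiffAt_const)).clm_apply
    (hφ'.clm_apply contDiffAt_const)

/-- Integration over the surface of a function supported in the domain of a graph chart. -/
theorem integrable_and_integral_eq (g : RiemannianMetric n) (h : IsGraphChart S O U φ π)
    {F : EuclideanSpace ℝ (Fin n) → ℂ} (hF : Continuous F) (hFO : ∀ x ∉ O, F x = 0)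
    (hint : IntegrableOn (fun a => Real.sqrt (pullbackMatrix g φ a).det • F (φ a)) U) :
    Integrable F (surfaceMeasure g S) ∧ ∫ x, F x ∂(surfaceMeasure g S) =
      ∫ a in U, Real.sqrt (pullbackMatrix g φ a).det • F (φ a) := by
  set J := fun a => ENNReal.ofReal (Real.sqrt (pullbackMatrix g φ a).det) with hJ
  have hJm : AEMeasurable J (volume.restrict U) := by
    refine ENNReal.measurable_ofReal.comp_aemeasurable ?_
    refine ContinuousOn.aemeasurable (fun a ha => ?_) h.isOpen_source.measurableSet
    exact (h.contDiffAt_sqrt_det g ha).continuousAt.continuousWithinAt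
  have hJt : ∀ᵐ a ∂(volume.restrict U), J a < ⊤ := Eventually.of_forall fun a => by simp [hJ]
  have hJr : ∀ a, (J a).toReal = Real.sqrt (pullbackMatrix g φ a).det := fun a =>
    ENNReal.toReal_ofReal (Real.sqrt_nonneg _)
  have hφm : AEMeasurable φ ((volume.restrict U).withDensity J) :=
    (h.smooth.continuousOn.aemeasurable h.isOpen_source.measurableSet).mono_ac
      (withDensity_absolutelyContinuous _ _)
  have hsupp : Function.support F ⊆ O := fun x hx => by
    by_contra hxO
    exact hx (hFO x hxO)
  constructor
  · rw [← integrableOn_iff_integrable_of_support_subset hsupp, IntegrableOn,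
      h.surfaceMeasure_restrict g, paramArea,
      integrable_map_measure hF.aestronglyMeasurable hφm,
      integrable_withDensity_iff_integrable_smul₀' hJm hJt]
    simp only [hJr, Function.comp_apply]
    exact hint
  · rw [← setIntegral_eq_integral_of_forall_compl_eq_zero hFO, h.surfaceMeasure_restrict g,
      paramArea, integral_map hφm hF.aestronglyMeasurable,
      integral_withDensity_eq_integral_toReal_smul₀ hJm hJt]
    simp only [hJr]

theorem fderiv_apply_mem_surfaceTangent (h : IsGraphChart S O U φ π)
    {a : EuclideanSpace ℝ (Fin (n - 1))} (ha : a ∈ U) (w : EuclideanSpace ℝ (Fin (n - 1))) :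
    fderiv ℝ φ a w ∈ surfaceTangent S (φ a) := by
  have hφ : ContDiffAt ℝ ∞ φ a := h.smooth.contDiffAt (h.isOpen_source.mem_nhds ha)
  have hline : ContDiff ℝ ∞ fun s : ℝ => a + s • w := by fun_prop
  have h0 : a + (0 : ℝ) • w = a := by simp
  refine ⟨fun s => φ (a + s • w), ?_, by simp, ?_, ?_⟩
  · exact ContDiffAt.comp (g := φ) (0 : ℝ) (by rwa [h0]) hline.contDiffAt
  · have hd : HasDerivAt (fun s : ℝ => a + s • w) w 0 := by
      simpa using ((hasDerivAt_id (0 : ℝ)).smul_const w).const_add a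
    have hφd : HasFDerivAt φ (fderiv ℝ φ a) (a + (0 : ℝ) • w) := by
      rw [h0]; exact (h.differentiableAt ha).hasFDerivAt
    exact (hφd.comp_hasDerivAt (0 : ℝ) hd).deriv
  · have : ∀ᶠ s in 𝓝 (0 : ℝ), a + s • w ∈ U := by
      refine hline.continuous.continuousAt.eventually_mem ?_
      rw [h0]
      exact h.isOpen_source.mem_nhds ha
    filter_upwards [this] with s hs using (h.mapsTo _ hs).1

end IsGraphChart

/-! ### The phase of the product. -/

/-- The difference `θ₁ - conj θ₂` of two phases, the phase of the product of one beam with the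
conjugate of the other, in the coordinates `(τ, w) ↦ (t₀ + τ, φ w)`. -/
noncomputable def chartPhase (θ₁ θ₂ : ℝ × EuclideanSpace ℝ (Fin n) → ℂ) (t₀ : ℝ)
    (φ : EuclideanSpace ℝ (Fin (n - 1)) → EuclideanSpace ℝ (Fin n))
    (y : ℝ × EuclideanSpace ℝ (Fin (n - 1))) : ℂ :=
  θ₁ (t₀ + y.1, φ y.2) - (starRingEnd ℂ) (θ₂ (t₀ + y.1, φ y.2))

theorem beamIntegrand_eq (θ₁ θ₂ u : ℝ × EuclideanSpace ℝ (Fin n) → ℂ) (ε : ℝ)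
    (q : ℝ × EuclideanSpace ℝ (Fin n)) :
    beamIntegrand θ₁ θ₂ u ε q =
      Complex.exp (Complex.I * (ε : ℂ)⁻¹ * (θ₁ q - (starRingEnd ℂ) (θ₂ q))) * u q := by
  rw [beamIntegrand, ← Complex.exp_conj, ← Complex.exp_add]
  congr 2
  simp only [map_mul, map_inv₀, Complex.conj_I, Complex.conj_ofReal]
  ring

section Phase

variable {T t₀ : ℝ} {θ₁ θ₂ : ℝ × EuclideanSpace ℝ (Fin n) → ℂ}
  {γ₁ γ₂ : ℝ → EuclideanSpace ℝ (Fin n)} {p₁ p₂ : ℝ → EuclideanSpace ℝ (Fin n) →L[ℝ] ℝ}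
  {H₁ H₂ : ℝ → Matrix (Fin n) (Fin n) ℂ}
  {S O : Set (EuclideanSpace ℝ (Fin n))} {U : Set (EuclideanSpace ℝ (Fin (n - 1)))}
  {φ : EuclideanSpace ℝ (Fin (n - 1)) → EuclideanSpace ℝ (Fin n)}
  {π : EuclideanSpace ℝ (Fin n) → EuclideanSpace ℝ (Fin (n - 1))}

theorem contDiffAt_chart (h : IsGraphChart S O U φ π)
    {y : ℝ × EuclideanSpace ℝ (Fin (n - 1))} (hyU : y.2 ∈ U) :
    ContDiffAt ℝ ∞ (fun y : ℝ × EuclideanSpace ℝ (Fin (n - 1)) => (t₀ + y.1, φ y.2)) y := by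
  have hφ : ContDiffAt ℝ ∞ φ y.2 := h.smooth.contDiffAt (h.isOpen_source.mem_nhds hyU)
  exact (contDiffAt_const.add contDiffAt_fst).prodMk (hφ.comp y contDiffAt_snd)

theorem contDiffAt_chartPhase (h : IsGraphChart S O U φ π) (hθ₁ : IsBeamPhase T θ₁ γ₁ p₁ H₁)
    (hθ₂ : IsBeamPhase T θ₂ γ₂ p₂ H₂) {y : ℝ × EuclideanSpace ℝ (Fin (n - 1))}
    (hyT : t₀ + y.1 ∈ Ioo 0 T) (hyU : y.2 ∈ U) :
    ContDiffAt ℝ ∞ (chartPhase θ₁ θ₂ t₀ φ) y := by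
  have hχ := contDiffAt_chart (t₀ := t₀) h hyU
  have h1 := (hθ₁.contDiffAt (q := (t₀ + y.1, φ y.2)) hyT).comp y hχ
  have h2 := (hθ₂.contDiffAt (q := (t₀ + y.1, φ y.2)) hyT).comp y hχ
  exact h1.sub (Complex.conjCLE.contDiff.contDiffAt.comp y h2)

/-- The phase of the product has a nondegenerate critical zero at the intersection point. -/
theorem chartPhase_critical (h : IsGraphChart S O U φ π)
    (h0U : (0 : EuclideanSpace ℝ (Fin (n - 1))) ∈ U)
    (ht₀ : t₀ ∈ Ioo 0 T) (hθ₁ : IsBeamPhase T θ₁ γ₁ p₁ H₁) (hθ₂ : IsBeamPhase T θ₂ γ₂ p₂ H₂)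
    (hγ₁ : γ₁ t₀ = φ 0) (hγ₂ : γ₂ t₀ = φ 0) (hvel : deriv γ₁ t₀ = deriv γ₂ t₀)
    (hp : p₁ t₀ = p₂ t₀) (htr : deriv γ₁ t₀ ∉ surfaceTangent S (φ 0))
    (hH₁ : ((H₁ t₀).map Complex.im).PosDef) (hH₂ : ((H₂ t₀).map Complex.im).PosDef) :
    chartPhase θ₁ θ₂ t₀ φ 0 = 0 ∧ fderiv ℝ (chartPhase θ₁ θ₂ t₀ φ) 0 = 0 ∧
      ∃ c > 0, ∀ᶠ y in 𝓝 0, c * ‖y‖ ^ 2 ≤ (chartPhase θ₁ θ₂ t₀ φ y).im := by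
  set Ψ := chartPhase θ₁ θ₂ t₀ φ with hΨ
  have hΨs : ContDiffAt ℝ ∞ Ψ 0 :=
    contDiffAt_chartPhase h hθ₁ hθ₂ (y := 0) (by simpa using ht₀) h0U
  have hz : ((t₀ + (0 : ℝ × EuclideanSpace ℝ (Fin (n - 1))).1,
      φ (0 : ℝ × EuclideanSpace ℝ (Fin (n - 1))).2) : ℝ × EuclideanSpace ℝ (Fin n)) =
      (t₀, φ 0) := by simp
  have e0 : Ψ 0 = 0 := by
    have h1 := hθ₁.apply_path ht₀
    have h2 := hθ₂.apply_path ht₀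
    rw [hγ₁] at h1
    rw [hγ₂] at h2
    rw [hΨ, chartPhase, hz, h1, h2]
    simp
  -- Both differentials are the same real covector, which conjugation leaves fixed.
  have e1 : fderiv ℝ Ψ 0 = 0 := by
    have hχ := ((contDiffAt_chart (t₀ := t₀) (y := 0) h h0U).differentiableAt
      (by simp)).hasFDerivAt
    set L := fderiv ℝ (fun y : ℝ × EuclideanSpace ℝ (Fin (n - 1)) => (t₀ + y.1, φ y.2)) 0
    have hd : ∀ (θ : ℝ × EuclideanSpace ℝ (Fin n) → ℂ) γ p H, IsBeamPhase T θ γ p H →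
        γ t₀ = φ 0 → HasFDerivAt (fun y : ℝ × EuclideanSpace ℝ (Fin (n - 1)) =>
          θ (t₀ + y.1, φ y.2)) ((fderiv ℝ θ (t₀, φ 0)).comp L) 0 := by
      intro θ γ p H hθ hγ
      refine HasFDerivAt.comp (g := θ)
        (f := fun y : ℝ × EuclideanSpace ℝ (Fin (n - 1)) => (t₀ + y.1, φ y.2)) 0 ?_ hχ
      rw [hz]
      exact ((hθ.contDiffAt (q := (t₀, φ 0)) ht₀).differentiableAt (by simp)).hasFDerivAt
    have h3 := (hd θ₁ γ₁ p₁ H₁ hθ₁ hγ₁).sub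
      (Complex.conjCLE.hasFDerivAt.comp 0 (hd θ₂ γ₂ p₂ H₂ hθ₂ hγ₂))
    refine HasFDerivAt.fderiv (f := Ψ) (f' := 0) (h3.congr_fderiv ?_)
    refine ContinuousLinearMap.ext fun y => ?_
    have f1 := hθ₁.fderiv_apply ht₀ (L y).1 (L y).2
    have f2 := hθ₂.fderiv_apply ht₀ (L y).1 (L y).2
    rw [hγ₁] at f1
    rw [hγ₂, ← hvel, ← hp] at f2
    simp only [Prod.mk.eta] at f1 f2
    simp [f1, f2]
  refine ⟨e0, e1, ?_⟩
  have hims : ContDiffAt ℝ ∞ (fun y => (Ψ y).im) 0 :=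
    Complex.imCLM.contDiff.contDiffAt.comp 0 hΨs
  refine eventually_mul_sq_le_of_critical (f := fun y => (Ψ y).im)
    (hims.of_le (WithTop.coe_le_coe.2 (le_top (a := (3 : ℕ∞))))) (by simp [e0]) ?_ ?_
  · have h4 : HasFDerivAt (fun y => (Ψ y).im) (Complex.imCLM.comp (fderiv ℝ Ψ 0)) 0 :=
      Complex.imCLM.hasFDerivAt.comp 0 (hΨs.differentiableAt (by simp)).hasFDerivAt
    rw [h4.fderiv, e1, ContinuousLinearMap.comp_zero]
  · rintro ⟨τ, w⟩ hy
    set z := fderiv ℝ φ 0 w - τ • deriv γ₁ t₀ with hzdef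
    -- If `z = 0` and `τ ≠ 0`, the velocity would be tangent to the surface; if `τ = 0`, injectivity
    -- of `dφ` forces `w = 0`.
    have hz0 : z ≠ 0 := by
      intro hzero
      rw [hzdef, sub_eq_zero] at hzero
      by_cases hτ : τ = 0
      · subst hτ
        rw [zero_smul] at hzero
        have hw : w = 0 := h.fderiv_injective h0U (by rw [hzero, map_zero])
        exact hy (by simp [hw])
      · refine htr ?_
        have hγw : deriv γ₁ t₀ = fderiv ℝ φ 0 (τ⁻¹ • w) := by
          rw [map_smul, hzero, smul_smul, inv_mul_cancel₀ hτ, one_smul]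
        rw [hγw]
        exact h.fderiv_apply_mem_surfaceTangent h0U _
    set v : ℝ → ℝ × EuclideanSpace ℝ (Fin n) := fun s => (s * τ, φ (s • w) - φ 0) with hv
    have hvlim : Tendsto (fun s => s⁻¹ • v s) (𝓝[>] 0) (𝓝 (τ, fderiv ℝ φ 0 w)) := by
      have hd : HasDerivAt (fun s : ℝ => φ (s • w)) (fderiv ℝ φ 0 w) 0 := by
        have hl : HasDerivAt (fun s : ℝ => s • w) w 0 := by
          simpa using (hasDerivAt_id (0 : ℝ)).smul_const w
        have hφd : HasFDerivAt φ (fderiv ℝ φ 0) ((0 : ℝ) • w) := by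
          rw [zero_smul]; exact (h.differentiableAt h0U).hasFDerivAt
        exact hφd.comp_hasDerivAt (0 : ℝ) hl
      have h5 := hd.tendsto_slope_zero_right
      simp only [zero_add, zero_smul] at h5
      refine Tendsto.congr' ?_ ((tendsto_const_nhds (x := τ)).prodMk_nhds h5)
      filter_upwards [self_mem_nhdsWithin] with s hs
      have hs : s ≠ 0 := ne_of_gt hs
      simp only [hv, Prod.smul_mk, smul_eq_mul]
      rw [inv_mul_cancel_left₀ hs]
    have l1 := hθ₁.tendsto_im_div_sq ht₀ hvlim
    have l2 := hθ₂.tendsto_im_div_sq ht₀ hvlim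
    rw [← hvel] at l2
    refine ⟨_, ?_, (l1.add l2).congr fun s => ?_⟩
    · have := im_quadForm_pos hH₁ hz0
      have := im_quadForm_pos hH₂ hz0
      positivity
    · have hpt : (t₀, φ 0) + v s = (t₀ + (s • (τ, w)).1, φ (s • (τ, w)).2) := by
        simp [hv]
      rw [hγ₁, hγ₂, hpt, hΨ]
      simp only [chartPhase, Complex.sub_im, Complex.conj_im]
      ring

end Phase

/-! ### The amplitude in the chart. -/

theorem continuous_of_continuousOn_of_eq_zero {X Y : Type*} [TopologicalSpace X]
    [TopologicalSpace Y] [Zero Y] {f : X → Y} {W K : Set X} (hW : IsOpen W) (hK : IsClosed K)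
    (hKW : K ⊆ W) (hf : ContinuousOn f W) (h0 : ∀ x ∉ K, f x = 0) : Continuous f := by
  refine continuous_iff_continuousAt.2 fun x => ?_
  by_cases hx : x ∈ W
  · exact hf.continuousAt (hW.mem_nhds hx)
  · have hxK : x ∈ Kᶜ := fun h => hx (hKW h)
    refine (continuousAt_const (y := (0 : Y))).congr ?_
    filter_upwards [hK.isOpen_compl.mem_nhds hxK] with y hy using (h0 y hy).symm

/-- The test function in the coordinates of a chart, multiplied by the density of the surface
measure and cut off outside the ball of radius `δ`. -/
noncomputable def chartAmplitude (g : RiemannianMetric n)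
    (u : ℝ × EuclideanSpace ℝ (Fin n) → ℂ) (t₀ δ : ℝ)
    (φ : EuclideanSpace ℝ (Fin (n - 1)) → EuclideanSpace ℝ (Fin n)) :
    ℝ × EuclideanSpace ℝ (Fin (n - 1)) → ℂ :=
  (Metric.ball 0 δ).indicator fun y =>
    Real.sqrt (pullbackMatrix g φ y.2).det • u (t₀ + y.1, φ y.2)

section Amplitude

variable {S O : Set (EuclideanSpace ℝ (Fin n))} {U : Set (EuclideanSpace ℝ (Fin (n - 1)))}
  {φ : EuclideanSpace ℝ (Fin (n - 1)) → EuclideanSpace ℝ (Fin n)}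
  {π : EuclideanSpace ℝ (Fin n) → EuclideanSpace ℝ (Fin (n - 1))}
  {u : ℝ × EuclideanSpace ℝ (Fin n) → ℂ} {t₀ δ : ℝ}

theorem chartAmplitude_contDiffAt (g : RiemannianMetric n) (h : IsGraphChart S O U φ π)
    (hδU : ∀ y ∈ Metric.ball (0 : ℝ × EuclideanSpace ℝ (Fin (n - 1))) δ, y.2 ∈ U)
    (hu : ContDiff ℝ ∞ u) {y : ℝ × EuclideanSpace ℝ (Fin (n - 1))} (hy : y ∈ Metric.ball 0 δ) :
    ContDiffAt ℝ ∞ (chartAmplitude g u t₀ δ φ) y := by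
  have hJ := (h.contDiffAt_sqrt_det g (hδU y hy)).comp y contDiffAt_snd
  have hu' := hu.contDiffAt.comp y (contDiffAt_chart (t₀ := t₀) h (hδU y hy))
  refine (hJ.smul hu').congr_of_eventuallyEq ?_
  filter_upwards [Metric.isOpen_ball.mem_nhds hy] with z hz
  rw [chartAmplitude, indicator_of_mem hz]
  rfl

/-- The indicator discards the uncontrolled values of `φ` off `U`. On `U` it changes nothing, since
the support of `u` already lies over the ball. -/
theorem chartAmplitude_eq (g : RiemannianMetric n) (h : IsGraphChart S O U φ π)
    (hsupp : tsupport u ⊆ {q | q.2 ∈ O ∧ (q.1 - t₀, π q.2) ∈ Metric.ball 0 δ})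
    {y : ℝ × EuclideanSpace ℝ (Fin (n - 1))} (hy : y.2 ∈ U) :
    chartAmplitude g u t₀ δ φ y =
      Real.sqrt (pullbackMatrix g φ y.2).det • u (t₀ + y.1, φ y.2) := by
  by_cases hb : y ∈ Metric.ball (0 : ℝ × EuclideanSpace ℝ (Fin (n - 1))) δ
  · rw [chartAmplitude, indicator_of_mem hb]
  · have hu0 : u (t₀ + y.1, φ y.2) = 0 := by
      by_contra hne
      have := (hsupp (subset_tsupport _ hne)).2
      simp only [add_sub_cancel_left, h.left_inv _ hy] at this
      exact hb this
    rw [chartAmplitude, indicator_of_notMem hb, hu0, smul_zero]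

/-- The amplitude vanishes off a compact subset of the ball. -/
theorem exists_isCompact_chartAmplitude (g : RiemannianMetric n) (h : IsGraphChart S O U φ π)
    (hS : IsClosed S) (hδU : ∀ y ∈ Metric.ball (0 : ℝ × EuclideanSpace ℝ (Fin (n - 1))) δ, y.2 ∈ U)
    (huc : HasCompactSupport u)
    (hsupp : tsupport u ⊆ {q | q.2 ∈ O ∧ (q.1 - t₀, π q.2) ∈ Metric.ball 0 δ}) :
    ∃ K : Set (ℝ × EuclideanSpace ℝ (Fin (n - 1))), IsCompact K ∧ K ⊆ Metric.ball 0 δ ∧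
      ∀ y ∉ K, chartAmplitude g u t₀ δ φ y = 0 := by
  have hπ : Continuous π := h.smooth_proj.continuous
  -- The compact set is the coordinate image of the part of the support of `u` lying over `S`;
  -- compactness uses that `S` is closed.
  refine ⟨(fun q : ℝ × EuclideanSpace ℝ (Fin n) => (q.1 - t₀, π q.2)) ''
    (tsupport u ∩ univ ×ˢ S), ?_, ?_, ?_⟩
  · refine IsCompact.image ?_ (by fun_prop)
    exact huc.isCompact.inter_right (isClosed_univ.prod hS)
  · rintro _ ⟨q, hq, rfl⟩
    exact (hsupp hq.1).2
  · intro y hy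
    by_contra hne
    have hb : y ∈ Metric.ball (0 : ℝ × EuclideanSpace ℝ (Fin (n - 1))) δ := by
      by_contra hb
      exact hne (indicator_of_notMem hb _)
    have hU := hδU y hb
    rw [chartAmplitude, indicator_of_mem hb] at hne
    have hune : u (t₀ + y.1, φ y.2) ≠ 0 := fun h0 => hne (by rw [h0, smul_zero])
    refine hy ⟨(t₀ + y.1, φ y.2), ⟨subset_tsupport _ hune, mem_univ _, (h.mapsTo _ hU).1⟩, ?_⟩
    simp [h.left_inv _ hU]

end Amplitude

theorem beamIntegrand_continuous {T t : ℝ} {θ₁ θ₂ u : ℝ × EuclideanSpace ℝ (Fin n) → ℂ}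
    {γ₁ γ₂ : ℝ → EuclideanSpace ℝ (Fin n)} {p₁ p₂ : ℝ → EuclideanSpace ℝ (Fin n) →L[ℝ] ℝ}
    {H₁ H₂ : ℝ → Matrix (Fin n) (Fin n) ℂ} (hθ₁ : IsBeamPhase T θ₁ γ₁ p₁ H₁)
    (hθ₂ : IsBeamPhase T θ₂ γ₂ p₂ H₂) (hu : Continuous u)
    (hT : ∀ q ∈ tsupport u, q.1 ∈ Ioo 0 T) (ε : ℝ) :
    Continuous fun x => beamIntegrand θ₁ θ₂ u ε (t, x) := by
  by_cases ht : t ∈ Ioo 0 T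
  · have h1 : Continuous fun x => θ₁ (t, x) := continuous_iff_continuousAt.2 fun x =>
      (hθ₁.contDiffAt (q := (t, x)) ht).continuousAt.comp (f := fun x => (t, x)) (by fun_prop)
    have h2 : Continuous fun x => θ₂ (t, x) := continuous_iff_continuousAt.2 fun x =>
      (hθ₂.contDiffAt (q := (t, x)) ht).continuousAt.comp (f := fun x => (t, x)) (by fun_prop)
    have h3 : Continuous fun x => u (t, x) := by fun_prop
    simp only [beamIntegrand_eq]
    have h4 := Complex.continuous_conj.comp h2
    exact (Complex.continuous_exp.comp (continuous_const.mul (h1.sub h4))).mul h3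
  · have : (fun x => beamIntegrand θ₁ θ₂ u ε (t, x)) = fun _ => 0 := by
      funext x
      have hu0 : u (t, x) = 0 := by
        by_contra hne
        exact ht (hT _ (subset_tsupport _ hne))
      rw [beamIntegrand, hu0, mul_zero]
    rw [this]
    exact continuous_const

/-- The volume of `ℝ × ℝᵐ` is a Haar measure. -/
theorem isAddHaarMeasure_volume_prod (m : ℕ) :
    (volume : Measure (ℝ × EuclideanSpace ℝ (Fin m))).IsAddHaarMeasure := by
  rw [Measure.volume_eq_prod]
  infer_instance

end Surface

/-! ### The asymptotics of the beam product. -/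

theorem lemma4p3 {n : ℕ} (g : RiemannianMetric n)
    (M : Set (EuclideanSpace ℝ (Fin n))) (hM : IsCompactSmoothDomain M)
    (T t₀ : ℝ) (ht₀ : t₀ ∈ Ioo 0 T)
    (θ₁ θ₂ : ℝ × EuclideanSpace ℝ (Fin n) → ℂ)
    (γ₁ γ₂ : ℝ → EuclideanSpace ℝ (Fin n))
    (p₁ p₂ : ℝ → EuclideanSpace ℝ (Fin n) →L[ℝ] ℝ)
    (H₁ H₂ : ℝ → Matrix (Fin n) (Fin n) ℂ)
    (hθ₁ : IsBeamPhase T θ₁ γ₁ p₁ H₁) (hθ₂ : IsBeamPhase T θ₂ γ₂ p₂ H₂)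
    (hB₁ : BeamConditions g M γ₁ p₁ H₁ t₀) (hB₂ : BeamConditions g M γ₂ p₂ H₂ t₀)
    (x₀ : EuclideanSpace ℝ (Fin n)) (hx₁ : γ₁ t₀ = x₀) (hx₂ : γ₂ t₀ = x₀)
    (hvel : deriv γ₁ t₀ = deriv γ₂ t₀) :
    ∃ V : Set (ℝ × EuclideanSpace ℝ (Fin n)), IsOpen V ∧ (t₀, x₀) ∈ V ∧
      ∀ u : ℝ × EuclideanSpace ℝ (Fin n) → ℂ,
        ContDiff ℝ ∞ u → HasCompactSupport u → tsupport u ⊆ V →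
        (∀ ε : ℝ, 0 < ε →
          (∀ t : ℝ, 0 < t → Integrable (fun x => beamIntegrand θ₁ θ₂ u ε (t, x))
            (surfaceMeasure g (frontier M))) ∧
          IntegrableOn (fun t => ∫ x, beamIntegrand θ₁ θ₂ u ε (t, x)
            ∂(surfaceMeasure g (frontier M))) (Ioi 0)) ∧
        ∃ β : ℂ,
          (fun ε : ℝ =>
            (∫ t in Ioi (0 : ℝ), ∫ x, beamIntegrand θ₁ θ₂ u ε (t, x)
              ∂(surfaceMeasure g (frontier M))) - β * ((ε ^ ((n : ℝ) / 2) : ℝ) : ℂ))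
            =O[𝓝[>] 0] (fun ε : ℝ => ε ^ ((n : ℝ) / 2 + 1)) ∧
          (β ≠ 0 ↔ u (t₀, x₀) ≠ 0) := by
  have hx₀ : x₀ ∈ frontier M := hx₁ ▸ hB₁.mem_boundary
  obtain ⟨O, U, φ, π, h, hx₀O, hπ₀⟩ := exists_isGraphChart hM hx₀
  have h0U : (0 : EuclideanSpace ℝ (Fin (n - 1))) ∈ U := hπ₀ ▸ h.proj_mem x₀ ⟨hx₀, hx₀O⟩
  have hφ0 : φ 0 = x₀ := by rw [← hπ₀]; exact h.right_inv x₀ ⟨hx₀, hx₀O⟩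
  have hp : p₁ t₀ = p₂ t₀ := by rw [hB₁.covector, hB₂.covector, hx₁, hx₂, hvel]
  have htr : deriv γ₁ t₀ ∉ surfaceTangent (frontier M) (φ 0) := by
    rw [hφ0, ← hx₁]; exact hB₁.transversal
  -- Truncated subtraction breaks this only for `n = 0`, where the velocity is zero, hence tangent,
  -- against transversality.
  have hn : n - 1 + 1 = n := by
    rcases Nat.eq_zero_or_pos n with rfl | hpos
    · refine absurd ?_ htr
      rw [Subsingleton.elim (deriv γ₁ t₀) (fderiv ℝ φ 0 0)]
      exact h.fderiv_apply_mem_surfaceTangent h0U 0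
    · omega
  obtain ⟨hΨ0, hΨ1, c, hc, him⟩ := chartPhase_critical h h0U ht₀ hθ₁ hθ₂ (hx₁.trans hφ0.symm)
    (hx₂.trans hφ0.symm) hvel hp htr hB₁.im_posDef hB₂.im_posDef
  set Ψ := chartPhase θ₁ θ₂ t₀ φ with hΨ
  have hΨs : ContDiffAt ℝ ∞ Ψ 0 :=
    contDiffAt_chartPhase h hθ₁ hθ₂ (y := 0) (by simpa using ht₀) h0U
  have hfin : Module.finrank ℝ (ℝ × EuclideanSpace ℝ (Fin (n - 1))) = n := by
    rw [Module.finrank_prod, Module.finrank_self, finrank_euclideanSpace_fin]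
    omega
  have hHaar := isAddHaarMeasure_volume_prod (n - 1)
  obtain ⟨G, hG, hlap⟩ := exists_laplace_asymptotics
    (volume : Measure (ℝ × EuclideanSpace ℝ (Fin (n - 1))))
    (hΨs.of_le (WithTop.coe_le_coe.2 (le_top (a := (4 : ℕ∞))))) hΨ0 hΨ1 hc him
  rw [hfin] at hlap
  have hgood : ∀ᶠ y : ℝ × EuclideanSpace ℝ (Fin (n - 1)) in 𝓝 0,
      c * ‖y‖ ^ 2 ≤ (Ψ y).im ∧ t₀ + y.1 ∈ Ioo 0 T ∧ y.2 ∈ U := by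
    refine him.and (Eventually.and ?_ ?_)
    · have hcont : Continuous fun y : ℝ × EuclideanSpace ℝ (Fin (n - 1)) => t₀ + y.1 := by
        fun_prop
      exact hcont.continuousAt.eventually_mem (isOpen_Ioo.mem_nhds (by simpa using ht₀))
    · exact continuous_snd.continuousAt.eventually_mem (h.isOpen_source.mem_nhds h0U)
  obtain ⟨δ, hδ, hball⟩ := Metric.eventually_nhds_iff_ball.1 hgood
  have hδU : ∀ y ∈ Metric.ball (0 : ℝ × EuclideanSpace ℝ (Fin (n - 1))) δ, y.2 ∈ U :=
    fun y hy => (hball y hy).2.2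
  have hπc : Continuous π := h.smooth_proj.continuous
  -- `V` is chosen before `u`: over it the chart coordinates stay in the ball where the lower bound
  -- on `Im Ψ`, the time interval and the chart domain are all under control.
  refine ⟨{q | q.2 ∈ O ∧ (q.1 - t₀, π q.2) ∈ Metric.ball 0 δ}, ?_, ?_, ?_⟩
  · refine (h.isOpen_target.preimage continuous_snd).inter (Metric.isOpen_ball.preimage
      (f := fun q : ℝ × EuclideanSpace ℝ (Fin n) => (q.1 - t₀, π q.2)) (by fun_prop))
  · refine ⟨hx₀O, ?_⟩
    simp only [sub_self, hπ₀]
    exact Metric.mem_ball_self hδ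
  intro u hu huc hsupp
  obtain ⟨K, hK, hKb, hK0⟩ := exists_isCompact_chartAmplitude g h isClosed_frontier hδU huc hsupp
  set a := chartAmplitude g u t₀ δ φ with ha
  have haU : ∀ y : ℝ × EuclideanSpace ℝ (Fin (n - 1)), y.2 ∈ U → a y =
      Real.sqrt (pullbackMatrix g φ y.2).det • u (t₀ + y.1, φ y.2) := fun y hy =>
    chartAmplitude_eq g h hsupp hy
  have hab : ∀ y, a y ≠ 0 → y ∈ Metric.ball (0 : ℝ × EuclideanSpace ℝ (Fin (n - 1))) δ :=
    fun y hy => hKb (by by_contra hyK; exact hy (hK0 y hyK))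
  have hacont : ContinuousOn a (Metric.ball 0 δ) := fun y hy =>
    (chartAmplitude_contDiffAt g h hδU hu hy).continuousAt.continuousWithinAt
  have hT : ∀ q ∈ tsupport u, q.1 ∈ Ioo 0 T := fun q hq => by
    simpa using (hball _ (hsupp hq).2).2.1
  -- the integrand in the chart
  set f : ℝ → ℝ × EuclideanSpace ℝ (Fin (n - 1)) → ℂ := fun ε y =>
    Complex.exp (Complex.I * (ε : ℂ)⁻¹ * Ψ y) * a y with hf
  have hf0 : ∀ ε, ∀ y ∉ K, f ε y = 0 := fun ε y hy => by rw [hf]; simp [hK0 y hy]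
  have hfc : ∀ ε, Continuous (f ε) := fun ε => by
    refine continuous_of_continuousOn_of_eq_zero Metric.isOpen_ball hK.isClosed hKb ?_ (hf0 ε)
    have hΨc : ContinuousOn Ψ (Metric.ball 0 δ) := fun y hy =>
      (contDiffAt_chartPhase h hθ₁ hθ₂ (hball y hy).2.1
        (hball y hy).2.2).continuousAt.continuousWithinAt
    exact (Complex.continuous_exp.comp_continuousOn (continuousOn_const.mul hΨc)).mul hacont
  have hfi : ∀ ε, Integrable (f ε) (volume.prod volume) := fun ε => by
    rw [← Measure.volume_eq_prod]
    exact (hfc ε).integrable_of_hasCompactSupport (HasCompactSupport.intro hK (hf0 ε))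
  have hfsec : ∀ ε t, (fun w => f ε (t - t₀, w)).support ⊆ U := fun ε t w hw => by
    by_contra hwU
    exact hw (by
      have : a (t - t₀, w) = 0 := by
        by_contra hne
        exact hwU (hδU _ (hab _ hne))
      simp [hf, this])
  have hfφ : ∀ ε t, ∀ w ∈ U, Real.sqrt (pullbackMatrix g φ w).det •
      beamIntegrand θ₁ θ₂ u ε (t, φ w) = f ε (t - t₀, w) := fun ε t w hw => by
    simp only [hf]
    rw [haU _ hw, beamIntegrand_eq, hΨ, chartPhase]
    simp only [add_sub_cancel, Complex.real_smul]
    ring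
  have hsurf : ∀ ε t, Integrable (fun x => beamIntegrand θ₁ θ₂ u ε (t, x))
      (surfaceMeasure g (frontier M)) ∧ ∫ x, beamIntegrand θ₁ θ₂ u ε (t, x)
        ∂(surfaceMeasure g (frontier M)) = ∫ w, f ε (t - t₀, w) := by
    intro ε t
    have hUm := h.isOpen_source.measurableSet
    have hsec : Integrable (fun w => f ε (t - t₀, w)) := by
      refine Continuous.integrable_of_hasCompactSupport ((hfc ε).comp (by fun_prop)) ?_
      refine HasCompactSupport.intro (hK.image continuous_snd) fun w hw => hf0 ε _ fun hyK => ?_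
      exact hw ⟨_, hyK, rfl⟩
    have hFO : ∀ x ∉ O, beamIntegrand θ₁ θ₂ u ε (t, x) = 0 := fun x hx => by
      have hu0 : u (t, x) = 0 := by
        by_contra hne
        exact hx (hsupp (subset_tsupport _ hne)).1
      rw [beamIntegrand, hu0, mul_zero]
    obtain ⟨hi, heq⟩ := h.integrable_and_integral_eq g
      (beamIntegrand_continuous (t := t) hθ₁ hθ₂ hu.continuous hT ε) hFO
      (hsec.integrableOn.congr_fun (fun w hw => (hfφ ε t w hw).symm) hUm)
    refine ⟨hi, ?_⟩
    rw [heq, setIntegral_congr_fun hUm (fun w hw => hfφ ε t w hw)]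
    exact setIntegral_eq_integral_of_forall_compl_eq_zero fun w hw => by
      by_contra hne
      exact hw (hfsec ε t hne)
  have htime : ∀ ε, Integrable (fun t => ∫ x, beamIntegrand θ₁ θ₂ u ε (t, x)
      ∂(surfaceMeasure g (frontier M))) := fun ε => by
    simp only [fun t => (hsurf ε t).2]
    exact (hfi ε).integral_prod_left.comp_sub_right t₀
  have htotal : ∀ ε, ∫ t in Ioi (0 : ℝ), ∫ x, beamIntegrand θ₁ θ₂ u ε (t, x)
      ∂(surfaceMeasure g (frontier M)) = ∫ y, f ε y := fun ε => by
    rw [setIntegral_eq_integral_of_forall_compl_eq_zero]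
    · simp only [fun t => (hsurf ε t).2]
      rw [integral_sub_right_eq_self (fun t => ∫ w, f ε (t, w)) t₀, Measure.volume_eq_prod,
        integral_prod _ (hfi ε)]
    · intro t ht
      have hz : ∀ x, beamIntegrand θ₁ θ₂ u ε (t, x) = 0 := fun x => by
        have hu0 : u (t, x) = 0 := by
          by_contra hne
          exact ht (hT _ (subset_tsupport _ hne)).1
        rw [beamIntegrand, hu0, mul_zero]
      simp [hz]
  -- `β = G * a 0`, with `G` the nonzero Gaussian integral, so `β` vanishes exactly when `u (t₀,
  -- x₀)` does.
  refine ⟨fun ε _ => ⟨fun t _ => (hsurf ε t).1, (htime ε).integrableOn⟩, G * a 0, ?_, ?_⟩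
  · have hac : Continuous a :=
      continuous_of_continuousOn_of_eq_zero Metric.isOpen_ball hK.isClosed hKb hacont hK0
    obtain ⟨A, hA⟩ := (HasCompactSupport.intro hK hK0).exists_bound_of_continuous hac
    have h2 : ContDiffAt ℝ 2 a 0 :=
      (chartAmplitude_contDiffAt g h hδU hu (Metric.mem_ball_self hδ)).of_le
        (WithTop.coe_le_coe.2 (le_top (a := (2 : ℕ∞))))
    have := hlap a A (fun y hy => (hball y (hab y hy)).1) hA h2
      (fun ε _ => (hfc ε).aestronglyMeasurable)
    simpa only [htotal] using this
  · have ha0 : a 0 = Real.sqrt (pullbackMatrix g φ 0).det • u (t₀, x₀) := by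
      rw [haU 0 h0U]
      simp [hφ0]
    have hJ : Real.sqrt (pullbackMatrix g φ 0).det ≠ 0 :=
      (Real.sqrt_pos.2 (h.det_pullbackMatrix_pos g h0U)).ne'
    rw [ha0]
    simp [hG, hJ]
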